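/- **Proposition 2.** There is an absolute constant $C>0$ such that the following holds for all integers $d\ge 1$, $n\ge 2$, all reals $\sigma>0$, $t>0$, and every probability distribution $p^\star$ on $\mathbb{R}^d$ that is $\sigma$-subgaussian in the sense that $\mathbb{E}_{X\sim p^\star}\big[\exp\big((X^\top\theta/\sigma)^2\big)\big]\le 2$ for every unit vector $\theta\in\mathbb{R}^d$. Let $X^{(1)},\dots,X^{(n)}$ be i.i.d. from $p^\star$, and let $Z_t$ be independent of them and distributed as $Z_0+\sqrt{t}\,W$, where $Z_0\sim p^\star$ and $W\sim\mathcal N(0,I_d)$ are independent. Let $\varphi_t(x)=(2\pi t)^{-d/2}\exp(-\|x\|_2^2/(2t))$, let $p_t(x)=\mathbb{E}[\varphi_t(Z_0-x)]$ be the density of $Z_t$, $s_t=\nabla\log p_t$ its score, and $J_t=J_{s_t}$ the Jacobian matrix of $s_t$. Define $$\widehat p_t(x)=\frac1n\sum_{i=1}^n\varphi_t(X^{(i)}-x),\qquad \widehat s_t(x)=\frac{\nabla\widehat p_t(x)}{\widehat p_t(x)}\,\psi\big(\widehat p_t(x);\eta_t\big),\qquad \eta_t=\frac{\log n}{n(2\pi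 t)^{d/2}},$$ where $\psi(x;\eta)=1$ for $x\ge\eta$, $\psi(x;\eta)=0$ for $x\le\eta/2$, and $$\psi(x;\eta)=\Big[1+\exp\Big(\frac{1-2(2x/\eta-1)}{(2x/\eta-1)(2-2x/\eta)}\Big)\Big]^{-1}\quad\text{for } \eta/2<x<\eta.$$ Then $s_t$ and $\widehat s_t$ (for every realization of the data) are differentiable on $\mathbb{R}^d$, and with $C_d=(4/\sqrt\pi)^d$ and $\|\cdot\|$ the spectral norm, $$\mathbb{E}\Big[\big\|J_{\widehat s_t}(Z_t)-J_t(Z_t)\big\|\Big]\le C\left\{\sqrt{\frac{C_d}{n}}\Big(\frac1t+\frac{\sigma^{d/2}}{t^{d/4+1}}\Big)(\log n)^{d/4+1}+\frac{C_d}{n}\Big(\frac1t+\frac{\sigma^d}{t^{d/2+1}}\Big)(\log n)^{d/2+2}\right\},$$ where the expectation (which is finite) is over the training data and $Z_t$. -/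

import Mathlib

open MeasureTheory ProbabilityTheory

noncomputable section

namespace ScoreEstimation

/-- `ℝ^d` with the Euclidean norm; operator norms on it are spectral norms. -/
abbrev E (d : ℕ) : Type := EuclideanSpace ℝ (Fin d)

/-- `p` is `σ`-subgaussian: `𝔼 exp((Xᵀθ/σ)²) ≤ 2` for `X ∼ p` and every unit vector `θ`
(in particular the expectation is finite). -/
def IsSubgaussian {d : ℕ} (p : Measure (E d)) (σ : ℝ) : Prop :=
  ∀ θ : E d, ‖θ‖ = 1 →
    Integrable (fun x : E d => Real.exp ((inner ℝ x θ / σ) ^ 2)) p ∧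
      ∫ x, Real.exp ((inner ℝ x θ / σ) ^ 2) ∂p ≤ 2

/-- `φ_t`, the density of `N(0, t I_d)`. -/
def gaussianKernel {d : ℕ} (t : ℝ) (x : E d) : ℝ :=
  1 / (2 * Real.pi * t) ^ ((d : ℝ) / 2) * Real.exp (-‖x‖ ^ 2 / (2 * t))

/-- The law of `Z_t = Z_0 + √t W`, where `Z_0 ∼ p` and `W ∼ N(0, I_d)` are independent. -/
def diffusedLaw {d : ℕ} (p : Measure (E d)) (t : ℝ) : Measure (E d) :=
  (p.prod (stdGaussian (E d))).map (fun z => z.1 + Real.sqrt t • z.2)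

/-- `p_t(x) = 𝔼[φ_t(Z_0 - x)]`, the continuous version of the density of `Z_t`
(see `diffusedLaw_eq_withDensity`). -/
def diffusedDensity {d : ℕ} (p : Measure (E d)) (t : ℝ) (x : E d) : ℝ :=
  ∫ y, gaussianKernel t (y - x) ∂p

/-- The score `s_t = ∇ log p_t` of `Z_t`. -/
def score {d : ℕ} (p : Measure (E d)) (t : ℝ) (x : E d) : E d :=
  gradient (fun y => Real.log (diffusedDensity p t y)) x

/-- The soft-thresholding function `ψ(x; η)`. -/
def softThreshold (η x : ℝ) : ℝ :=
  if η ≤ x then 1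
  else if x ≤ η / 2 then 0
  else (1 + Real.exp ((1 - 2 * (2 * x / η - 1)) / ((2 * x / η - 1) * (2 - 2 * x / η))))⁻¹

/-- The threshold `η_t = log n / (n (2πt)^{d/2})`. -/
def threshold (d n : ℕ) (t : ℝ) : ℝ :=
  Real.log n / (n * (2 * Real.pi * t) ^ ((d : ℝ) / 2))

/-- The kernel density estimator `p̂_t` built from the data `X`. -/
def densityEstimator {d n : ℕ} (X : Fin n → E d) (t : ℝ) (x : E d) : ℝ :=
  1 / (n : ℝ) * ∑ i, gaussianKernel t (X i - x)

/-- The regularized score estimator `ŝ_t = (∇p̂_t / p̂_t) ψ(p̂_t; η_t)` built from the data `X`. -/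
def scoreEstimator {d n : ℕ} (X : Fin n → E d) (t : ℝ) (x : E d) : E d :=
  (softThreshold (threshold d n t) (densityEstimator X t x) / densityEstimator X t x) •
    gradient (densityEstimator X t) x

/-- The Jacobian of a vector field at a point, as a linear operator. -/
def jacobian {d : ℕ} (f : E d → E d) (x : E d) : E d →L[ℝ] E d := fderiv ℝ f x

/-- The dimensional constant `C_d = (4/√π)^d`. -/
def dimConst (d : ℕ) : ℝ := (4 / Real.sqrt Real.pi) ^ d

lemma gaussianKernel_nonneg {d : ℕ} {t : ℝ} (ht : 0 < t) (x : E d) : 0 ≤ gaussianKernel t x := by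
  unfold gaussianKernel; positivity

lemma continuous_gaussianKernel {d : ℕ} (t : ℝ) :
    Continuous (gaussianKernel t : E d → ℝ) := by
  unfold gaussianKernel; fun_prop

lemma integrable_gaussianKernel {d : ℕ} {t : ℝ} (ht : 0 < t) :
    Integrable (gaussianKernel t : E d → ℝ) := by
  have h := (GaussianFourier.integrable_cexp_neg_mul_sq_norm_add (V := E d)
    (b := ((1 / (2 * t) : ℝ) : ℂ)) (by rw [Complex.ofReal_re]; positivity) 0 0).re
  refine (h.const_mul (1 / (2 * Real.pi * t) ^ ((d : ℝ) / 2))).congr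
    (Filter.Eventually.of_forall fun x => ?_)
  simp only [gaussianKernel]
  congr 1
  have : (-((1 / (2 * t) : ℝ) : ℂ) * (‖x‖ : ℂ) ^ 2 + 0 * ((inner ℝ (0 : E d) x : ℝ) : ℂ))
      = ((-‖x‖ ^ 2 / (2 * t) : ℝ) : ℂ) := by
    push_cast; ring
  simp only [this]
  exact Complex.exp_ofReal_re _

/-- `φ_t` is the density of `√t W` for `W ∼ N(0, I_d)`. -/
lemma map_stdGaussian_eq_withDensity {d : ℕ} {t : ℝ} (ht : 0 < t) :
    (stdGaussian (E d)).map (fun w => Real.sqrt t • w) =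
      volume.withDensity (fun x => ENNReal.ofReal (gaussianKernel t x)) := by
  have hfin : IsFiniteMeasure
      (volume.withDensity (fun x : E d => ENNReal.ofReal (gaussianKernel t x))) :=
    isFiniteMeasure_withDensity_ofReal (integrable_gaussianKernel ht).2
  have := Measure.isProbabilityMeasure_map (μ := stdGaussian (E d))
    (f := fun w => Real.sqrt t • w) (by fun_prop)
  refine Measure.ext_of_charFun ?_
  ext ξ
  rw [charFun_map_smul, charFun_stdGaussian, charFun_apply,
    integral_withDensity_eq_integral_toReal_smul
      ((continuous_gaussianKernel t).measurable.ennreal_ofReal)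
      (Filter.Eventually.of_forall fun _ => ENNReal.ofReal_lt_top)]
  have h := GaussianFourier.integral_cexp_neg_mul_sq_norm_add (V := E d)
    (b := ((1 / (2 * t) : ℝ) : ℂ)) (by rw [Complex.ofReal_re]; positivity) Complex.I ξ
  have hc : (2 * Real.pi * t) ^ ((d : ℝ) / 2) ≠ 0 := by positivity
  have e : ∀ x : E d, (ENNReal.ofReal (gaussianKernel t x)).toReal •
      Complex.exp ((inner ℝ x ξ : ℝ) * Complex.I) =
      ((1 / (2 * Real.pi * t) ^ ((d : ℝ) / 2) : ℝ) : ℂ) *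
        Complex.exp (-((1 / (2 * t) : ℝ) : ℂ) * (‖x‖ : ℂ) ^ 2
          + Complex.I * (inner ℝ ξ x : ℝ)) := by
    intro x
    rw [ENNReal.toReal_ofReal (gaussianKernel_nonneg ht x), Complex.real_smul,
      Complex.exp_add, gaussianKernel, real_inner_comm]
    push_cast
    rw [mul_assoc]
    congr 3
    · congr 1; ring
    · ring
  simp_rw [e]
  rw [integral_const_mul, h]
  have e1 : ((Real.pi : ℂ) / ((1 / (2 * t) : ℝ) : ℂ)) = ((2 * Real.pi * t : ℝ) : ℂ) := by
    push_cast
    have : (t : ℂ) ≠ 0 := by exact_mod_cast ht.ne'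
    field_simp
  have e2 : ((Module.finrank ℝ (E d) : ℂ) / 2) = (((d : ℝ) / 2 : ℝ) : ℂ) := by simp
  rw [e1, e2, ← Complex.ofReal_cpow (by positivity), ← mul_assoc, ← Complex.ofReal_mul,
    one_div_mul_cancel hc, Complex.ofReal_one, one_mul, norm_smul]
  congr 1
  rw [Complex.I_sq, Real.norm_of_nonneg (Real.sqrt_nonneg t), ← Complex.ofReal_pow,
    mul_pow, Real.sq_sqrt ht.le]
  have : (t : ℂ) ≠ 0 := by exact_mod_cast ht.ne'
  push_cast
  field_simp
  try ring

/-- `p_t` is a density of `Z_t`. -/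
theorem diffusedLaw_eq_withDensity {d : ℕ} (p : Measure (E d)) [IsProbabilityMeasure p]
    {t : ℝ} (ht : 0 < t) :
    diffusedLaw p t = volume.withDensity (fun x => ENNReal.ofReal (diffusedDensity p t x)) := by
  have hk : Measurable fun x : E d => ENNReal.ofReal (gaussianKernel t x) :=
    (continuous_gaussianKernel t).measurable.ennreal_ofReal
  have hsymm : ∀ x y : E d, gaussianKernel t (x - y) = gaussianKernel t (y - x) := by
    intro x y; simp only [gaussianKernel, norm_sub_rev x y]
  have hd : ∀ x, ENNReal.ofReal (diffusedDensity p t x)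
      = ∫⁻ y, ENNReal.ofReal (gaussianKernel t (y - x)) ∂p := by
    intro x
    refine ofReal_integral_eq_lintegral_ofReal ?_
      (Filter.Eventually.of_forall fun y => gaussianKernel_nonneg ht _)
    refine Integrable.of_bound (C := 1 / (2 * Real.pi * t) ^ ((d : ℝ) / 2))
      ((continuous_gaussianKernel t).comp (by fun_prop)).aestronglyMeasurable
      (Filter.Eventually.of_forall fun y => ?_)
    rw [Real.norm_of_nonneg (gaussianKernel_nonneg ht _), gaussianKernel]
    refine mul_le_of_le_one_right (by positivity) (Real.exp_le_one_iff.2 ?_)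
    rw [neg_div]
    exact neg_nonpos.2 (by positivity)
  refine Measure.ext_of_lintegral _ fun f hf => ?_
  simp_rw [hd]
  have hm : Measurable fun z : E d × E d => ENNReal.ofReal (gaussianKernel t (z.2 - z.1)) :=
    hk.comp (measurable_snd.sub measurable_fst)
  rw [diffusedLaw, lintegral_map hf (by fun_prop), lintegral_prod _ (by fun_prop),
    lintegral_withDensity_eq_lintegral_mul _ hm.lintegral_prod_right' hf]
  have step : ∀ y : E d, ∫⁻ w, f (y + Real.sqrt t • w) ∂stdGaussian (E d)
      = ∫⁻ x, ENNReal.ofReal (gaussianKernel t (y - x)) * f x := by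
    intro y
    have h1 : ∫⁻ w, f (y + Real.sqrt t • w) ∂stdGaussian (E d)
        = ∫⁻ v, f (y + v) ∂((stdGaussian (E d)).map (fun w => Real.sqrt t • w)) := by
      rw [lintegral_map (by fun_prop) (by fun_prop)]
    rw [h1, map_stdGaussian_eq_withDensity ht,
      lintegral_withDensity_eq_lintegral_mul _ hk (by fun_prop),
      ← lintegral_add_left_eq_self (μ := volume)
        (fun x => ENNReal.ofReal (gaussianKernel t (y - x)) * f x) y]
    refine lintegral_congr fun v => ?_
    rw [hsymm y (y + v)]
    simp
  simp_rw [step]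
  rw [lintegral_lintegral_swap]
  · refine lintegral_congr fun x => ?_
    rw [Pi.mul_apply, lintegral_mul_const]
    exact hk.comp (measurable_id.sub_const x)
  · exact ((hk.comp (measurable_fst.sub measurable_snd)).mul
      (hf.comp measurable_snd)).aemeasurable

end ScoreEstimation

end

open ScoreEstimation

open MeasureTheory ProbabilityTheory

noncomputable section

namespace ScoreEstimation

/-! In units of `√t`, write `P`, `a`, `B` for the Gaussian moments of orders 0, 1, 2 of a measure
around `x`. Its score has Jacobian `(1/t)(B/P - I - aaᵀ/P²)`. The estimator is built from the same
expressions for the empirical measure, with a cutoff at `P = η`, where `η = log n / n` once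
normalizing constants cancel. Everything reduces to comparing moments of two measures.

Two deterministic facts drive the comparison. Since `‖w‖² = -2 log (bump w)`, concavity of `-k log
k` gives `‖B‖ ≤ 2P(1 + log (1/P))`, so Jacobians have only logarithmic size in `1/P`, and the
thresholded one has size `O(log n)`. Where `P ≥ 2η`, quotient perturbation bounds the error by `log
n` times the relative moment gap. Where `P < 2η`, logarithmic growth is absorbed into `(η/P)^(3/4)`.
This is `exists_norm_thresholdedJacobian_sub_le`.

For fixed `x`, a variance computation gives an expected gap of at most `4√(P/n)`
(`lintegral_momentGap_le`). It remains to integrate `P^(-1/2)` and `P^(-3/4)` over `Z_t`, whose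
density is proportional to `P`. Hölder with a Gaussian weight trades the missing integrability of
`P⁻¹` for an exponential square moment of `Z_t`, giving `(12 max(1, σ²/t))^(θd/2)` up to a factor 2
(`IsSubgaussian.lintegral_mass_rpow_neg_le`).

With `y = log n * rate`, the two contributions are of order `y` and `y^(3/2) ≤ (y + y²)/2`, which is
why the final bound has two terms. The base 12 is absorbed by `(16/π) log n` when `log n ≥ 3`;
smaller samples use the moment of order `-1/4` instead. -/

open InnerProductSpace (rankOne)

/-! ### Gaussian moments at scale `√t` and their size. -/

section Kernel

variable {d : ℕ}

/-- The unnormalized standard Gaussian density. -/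
def bump (w : E d) : ℝ := Real.exp (-‖w‖ ^ 2 / 2)

/-- The displacement from `x` to `y` in units of `√t`. -/
def displacement (t : ℝ) (x y : E d) : E d := (Real.sqrt t)⁻¹ • (y - x)

/-- The Gaussian average of `μ` around `x` at scale `√t`. -/
def mass (μ : Measure (E d)) (t : ℝ) (x : E d) : ℝ :=
  ∫ y, bump (displacement t x y) ∂μ

/-- The first Gaussian moment of `μ` around `x` at scale `√t`. -/
def firstMoment (μ : Measure (E d)) (t : ℝ) (x : E d) : E d :=
  ∫ y, bump (displacement t x y) • displacement t x y ∂μ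

/-- The second Gaussian moment of `μ` around `x` at scale `√t`. -/
def secondMoment (μ : Measure (E d)) (t : ℝ) (x : E d) : E d →L[ℝ] E d :=
  ∫ y, bump (displacement t x y) • rankOne ℝ (displacement t x y) (displacement t x y) ∂μ

lemma bump_pos (w : E d) : 0 < bump w := Real.exp_pos _

lemma bump_le_one (w : E d) : bump w ≤ 1 := by
  unfold bump
  rw [Real.exp_le_one_iff]
  have := sq_nonneg ‖w‖
  linarith

lemma bump_mul_norm_sq_le (w : E d) : bump w * ‖w‖ ^ 2 ≤ 1 := by
  have h := Real.quadratic_le_exp_of_nonneg (x := ‖w‖ ^ 2 / 2) (by positivity)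
  have h2 : bump w * Real.exp (‖w‖ ^ 2 / 2) = 1 := by
    rw [bump, ← Real.exp_add]; simp; ring
  rw [← h2]
  refine mul_le_mul_of_nonneg_left ?_ (bump_pos w).le
  nlinarith [sq_nonneg (‖w‖ ^ 2 / 2 - 1)]

lemma bump_mul_norm_le (w : E d) : bump w * ‖w‖ ≤ 1 := by
  have h := bump_mul_norm_sq_le w
  have h1 := bump_le_one w
  have h0 := bump_pos w
  nlinarith [sq_nonneg (‖w‖ - 1)]

/-- Makes the squared entries of the second-moment integrand sum to at most `4 * bump w`, so its
sampling variance is controlled by the mass with no factor of `d`. -/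
lemma bump_mul_norm_pow_four_le (w : E d) : bump w * ‖w‖ ^ 4 ≤ 4 := by
  have h := Real.quadratic_le_exp_of_nonneg (x := ‖w‖ ^ 2 / 4) (by positivity)
  have h2 : Real.exp (‖w‖ ^ 2 / 4) ^ 2 * bump w = 1 := by
    rw [bump, ← Real.exp_nat_mul, ← Real.exp_add]
    simp only [Real.exp_eq_one_iff]; push_cast; ring
  have h3 : ‖w‖ ^ 2 ≤ 2 * Real.exp (‖w‖ ^ 2 / 4) := by
    nlinarith [sq_nonneg (‖w‖ ^ 2 / 4 - 1)]
  have h4 : ‖w‖ ^ 4 ≤ 4 * Real.exp (‖w‖ ^ 2 / 4) ^ 2 := by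
    nlinarith [sq_nonneg ‖w‖]
  calc bump w * ‖w‖ ^ 4 ≤ bump w * (4 * Real.exp (‖w‖ ^ 2 / 4) ^ 2) :=
        mul_le_mul_of_nonneg_left h4 (bump_pos w).le
    _ = 4 * (Real.exp (‖w‖ ^ 2 / 4) ^ 2 * bump w) := by ring
    _ = 4 := by rw [h2, mul_one]

lemma continuous_bump : Continuous (bump : E d → ℝ) := by
  unfold bump; fun_prop

lemma continuous_displacement_right (t : ℝ) (x : E d) : Continuous (displacement t x) := by
  unfold displacement; fun_prop

lemma continuous_bump_displacement (t : ℝ) (x : E d) :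
    Continuous fun y => bump (displacement t x y) :=
  continuous_bump.comp (continuous_displacement_right t x)

lemma continuous_rankOne_self : Continuous fun w : E d => rankOne ℝ w w := by
  simp_rw [InnerProductSpace.rankOne_def]
  fun_prop

lemma continuous_bump_smul_rankOne (t : ℝ) (x : E d) :
    Continuous fun y => bump (displacement t x y) •
      rankOne ℝ (displacement t x y) (displacement t x y) :=
  (continuous_bump_displacement t x).smul
    (continuous_rankOne_self.comp (continuous_displacement_right t x))

lemma continuous_bump_smul (t : ℝ) (x : E d) :
    Continuous fun y => bump (displacement t x y) • displacement t x y :=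
  (continuous_bump_displacement t x).smul (continuous_displacement_right t x)

lemma norm_bump_smul_le (w : E d) : ‖bump w • w‖ ≤ 1 := by
  rw [norm_smul, Real.norm_of_nonneg (bump_pos w).le]
  exact bump_mul_norm_le w

lemma norm_bump_smul_rankOne (w : E d) : ‖bump w • rankOne ℝ w w‖ = bump w * ‖w‖ ^ 2 := by
  rw [norm_smul, Real.norm_of_nonneg (bump_pos w).le, InnerProductSpace.norm_rankOne, sq]

section Moments

variable (μ : Measure (E d)) [IsProbabilityMeasure μ] (t : ℝ) (x : E d)

lemma integrable_bump : Integrable (fun y => bump (displacement t x y)) μ :=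
  Integrable.of_bound (C := 1) (continuous_bump_displacement t x).aestronglyMeasurable
    (.of_forall fun y => by
      rw [Real.norm_of_nonneg (bump_pos _).le]; exact bump_le_one _)

lemma integrable_bump_smul :
    Integrable (fun y => bump (displacement t x y) • displacement t x y) μ :=
  Integrable.of_bound (C := 1) (continuous_bump_smul t x).aestronglyMeasurable
    (.of_forall fun _ => norm_bump_smul_le _)

lemma integrable_bump_smul_rankOne :
    Integrable (fun y => bump (displacement t x y) •
      rankOne ℝ (displacement t x y) (displacement t x y)) μ :=
  Integrable.of_bound (C := 1) (continuous_bump_smul_rankOne t x).aestronglyMeasurable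
    (.of_forall fun _ => by
      rw [norm_bump_smul_rankOne]; exact bump_mul_norm_sq_le _)

lemma integrable_bump_mul_norm_sq :
    Integrable (fun y => bump (displacement t x y) * ‖displacement t x y‖ ^ 2) μ := by
  simpa only [norm_bump_smul_rankOne] using (integrable_bump_smul_rankOne μ t x).norm

lemma integrable_bump_mul_norm :
    Integrable (fun y => bump (displacement t x y) * ‖displacement t x y‖) μ := by
  refine (integrable_bump_smul μ t x).norm.congr (.of_forall fun y => ?_)
  simp only [norm_smul, Real.norm_of_nonneg (bump_pos _).le]

lemma mass_pos : 0 < mass μ t x := by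
  rw [mass, integral_pos_iff_support_of_nonneg (fun _ => (bump_pos _).le)
    (integrable_bump μ t x)]
  simp [Function.support, (bump_pos _).ne']

lemma mass_le_one : mass μ t x ≤ 1 := by
  calc mass μ t x ≤ ∫ _, (1 : ℝ) ∂μ :=
        integral_mono (integrable_bump μ t x) (integrable_const _) fun _ => bump_le_one _
    _ = 1 := by simp

/-- Jensen's inequality for the concave function `k ↦ -k log k`. -/
lemma integral_bump_mul_norm_sq_le :
    ∫ y, bump (displacement t x y) * ‖displacement t x y‖ ^ 2 ∂μ
      ≤ 2 * (mass μ t x * Real.log (1 / mass μ t x)) := by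
  have hP := mass_pos μ t x
  set P := mass μ t x with hPdef
  -- The tangent line to `k ↦ -2 k log k` at `k = P`, evaluated at `k = bump w`, where `-2 log k =
  -- ‖w‖²`.
  have key : ∀ y, bump (displacement t x y) * ‖displacement t x y‖ ^ 2 ≤
      2 * (Real.log (1 / P) - 1) * bump (displacement t x y) + 2 * P := by
    intro y
    set w := displacement t x y
    have hk := bump_pos w
    have h := Real.log_le_sub_one_of_pos (x := P / bump w) (by positivity)
    rw [Real.log_div hP.ne' hk.ne'] at h
    have hl : Real.log (bump w) = -‖w‖ ^ 2 / 2 := by rw [bump, Real.log_exp]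
    rw [hl] at h
    have h2 : bump w * (P / bump w) = P := by field_simp
    rw [one_div, Real.log_inv]
    nlinarith [mul_le_mul_of_nonneg_left h hk.le]
  calc _ ≤ ∫ y, (2 * (Real.log (1 / P) - 1) * bump (displacement t x y) + 2 * P) ∂μ :=
        integral_mono (integrable_bump_mul_norm_sq μ t x)
          (((integrable_bump μ t x).const_mul _).add (integrable_const _)) key
    _ = 2 * (Real.log (1 / P) - 1) * P + 2 * P := by
        rw [integral_add ((integrable_bump μ t x).const_mul _) (integrable_const _),
          integral_const_mul]
        simp [hPdef, mass]
    _ = _ := by ring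

/-- The logarithmic size of the Gaussian average. -/
def logMass : ℝ := 1 + Real.log (1 / mass μ t x)

lemma one_le_logMass : 1 ≤ logMass μ t x := by
  have : 0 ≤ Real.log (1 / mass μ t x) :=
    Real.log_nonneg (by rw [le_div_iff₀ (mass_pos μ t x)]; simpa using mass_le_one μ t x)
  unfold logMass; linarith

lemma integral_bump_mul_norm_sq_le_logMass :
    ∫ y, bump (displacement t x y) * ‖displacement t x y‖ ^ 2 ∂μ
      ≤ 2 * (mass μ t x * logMass μ t x) := by
  have := integral_bump_mul_norm_sq_le μ t x
  have hP := mass_pos μ t x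
  unfold logMass
  nlinarith

lemma norm_secondMoment_le : ‖secondMoment μ t x‖ ≤ 2 * (mass μ t x * logMass μ t x) := by
  refine (norm_integral_le_integral_norm _).trans ?_
  simp only [norm_bump_smul_rankOne]
  exact integral_bump_mul_norm_sq_le_logMass μ t x

lemma norm_firstMoment_le : ‖firstMoment μ t x‖ ≤ 2 * (mass μ t x * √(logMass μ t x)) := by
  have hl : 1 ≤ √(logMass μ t x) := by
    rw [Real.one_le_sqrt]; exact one_le_logMass μ t x
  have hsq : √(logMass μ t x) ^ 2 = logMass μ t x :=
    Real.sq_sqrt (zero_le_one.trans (one_le_logMass μ t x))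
  set s := √(logMass μ t x)
  have hs : 0 < s := by linarith
  have hB := integral_bump_mul_norm_sq_le_logMass μ t x
  -- Cauchy–Schwarz in its AM-GM form; the weight `s = √(logMass)` balances the two terms after
  -- integration.
  have key : ∀ y, bump (displacement t x y) * ‖displacement t x y‖ ≤
      s / 2 * bump (displacement t x y)
        + 1 / (2 * s) * (bump (displacement t x y) * ‖displacement t x y‖ ^ 2) := by
    intro y
    set w := displacement t x y
    have hk := bump_pos w
    have : ‖w‖ ≤ s / 2 + 1 / (2 * s) * ‖w‖ ^ 2 := by
      have : s / 2 + 1 / (2 * s) * ‖w‖ ^ 2 - ‖w‖ = (s - ‖w‖) ^ 2 / (2 * s) := by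
        field_simp; ring
      have h2 : 0 ≤ (s - ‖w‖) ^ 2 / (2 * s) := by positivity
      linarith
    nlinarith [mul_le_mul_of_nonneg_left this hk.le]
  calc ‖firstMoment μ t x‖ ≤ ∫ y, bump (displacement t x y) * ‖displacement t x y‖ ∂μ := by
        refine (norm_integral_le_integral_norm _).trans (le_of_eq ?_)
        simp only [norm_smul, Real.norm_of_nonneg (bump_pos _).le]
    _ ≤ ∫ y, (s / 2 * bump (displacement t x y)
        + 1 / (2 * s) * (bump (displacement t x y) * ‖displacement t x y‖ ^ 2)) ∂μ :=
        integral_mono (integrable_bump_mul_norm μ t x)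
          (((integrable_bump μ t x).const_mul _).add
            ((integrable_bump_mul_norm_sq μ t x).const_mul _)) key
    _ = s / 2 * mass μ t x
        + 1 / (2 * s) * ∫ y, bump (displacement t x y) * ‖displacement t x y‖ ^ 2 ∂μ := by
        rw [integral_add ((integrable_bump μ t x).const_mul _)
          ((integrable_bump_mul_norm_sq μ t x).const_mul _), integral_const_mul,
          integral_const_mul, mass]
    _ ≤ s / 2 * mass μ t x + 1 / (2 * s) * (2 * (mass μ t x * s ^ 2)) := by
        rw [hsq]; gcongr
    _ = 3 / 2 * (mass μ t x * s) := by field_simp; ring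
    _ ≤ _ := by
        have := mul_pos (mass_pos μ t x) hs
        linarith

end Moments

/-! ### Differentiation of the moments under the integral sign. -/

section Derivatives

lemma hasFDerivAt_displacement (t : ℝ) (x y : E d) :
    HasFDerivAt (fun x => displacement t x y) (-(√t)⁻¹ • ContinuousLinearMap.id ℝ (E d)) x := by
  unfold displacement
  have := ((hasFDerivAt_id (𝕜 := ℝ) x).const_sub y).const_smul (√t)⁻¹
  refine this.congr_fderiv ?_
  ext v; simp

lemma hasFDerivAt_bump (w : E d) : HasFDerivAt bump (-bump w • innerSL ℝ w) w := by
  unfold bump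
  have h := ((hasStrictFDerivAt_norm_sq w).hasFDerivAt.const_mul (-(1 / 2 : ℝ))).exp
  convert! h using 1
  · ext v; congr 1; ring
  · ext v
    simp only [smul_apply, innerSL_apply_apply, smul_eq_mul, neg_smul, neg_apply, nsmul_eq_mul]
    rw [show (-(1 / 2) * ‖w‖ ^ 2) = -‖w‖ ^ 2 / 2 by ring]
    push_cast
    ring

lemma hasFDerivAt_bump_displacement (t : ℝ) (x y : E d) :
    HasFDerivAt (fun x => bump (displacement t x y))
      ((√t)⁻¹ • bump (displacement t x y) • innerSL ℝ (displacement t x y)) x := by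
  refine ((hasFDerivAt_bump (displacement t x y)).comp x
    (hasFDerivAt_displacement t x y)).congr_fderiv ?_
  ext v
  simp only [ContinuousLinearMap.comp_apply, smul_apply, innerSL_apply_apply, smul_eq_mul,
    neg_smul, neg_apply, ContinuousLinearMap.id_apply, inner_neg_right, inner_smul_right]
  ring

lemma hasFDerivAt_bump_smul_displacement (t : ℝ) (x y : E d) :
    HasFDerivAt (fun x => bump (displacement t x y) • displacement t x y)
      ((√t)⁻¹ • (bump (displacement t x y) •
          rankOne ℝ (displacement t x y) (displacement t x y)
        - bump (displacement t x y) • ContinuousLinearMap.id ℝ (E d))) x := by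
  refine ((hasFDerivAt_bump_displacement t x y).smul
    (hasFDerivAt_displacement t x y)).congr_fderiv ?_
  ext1 v
  simp only [add_apply, smul_apply, sub_apply,
    ContinuousLinearMap.smulRight_apply, InnerProductSpace.rankOne_apply, innerSL_apply_apply,
    ContinuousLinearMap.id_apply, smul_eq_mul]
  module

variable (μ : Measure (E d)) [IsProbabilityMeasure μ] (t : ℝ) (x : E d)

lemma hasFDerivAt_mass :
    HasFDerivAt (mass μ t) ((√t)⁻¹ • innerSL ℝ (firstMoment μ t x)) x := by
  have h := hasFDerivAt_integral_of_dominated_of_fderiv_le (𝕜 := ℝ) (μ := μ) (s := Set.univ)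
    (F := fun x y => bump (displacement t x y))
    (F' := fun x y => (√t)⁻¹ • bump (displacement t x y) • innerSL ℝ (displacement t x y))
    (x₀ := x) (bound := fun _ => (√t)⁻¹) Filter.univ_mem
    (.of_forall fun x => (continuous_bump_displacement t x).aestronglyMeasurable)
    (integrable_bump μ t x)
    (by
      refine Continuous.aestronglyMeasurable ?_
      exact ((continuous_bump_displacement t x).smul
        ((innerSL ℝ).continuous.comp (continuous_displacement_right t x))).const_smul (√t)⁻¹)
    (.of_forall fun y x _ => by
      rw [norm_smul, Real.norm_of_nonneg (by positivity), norm_smul, innerSL_apply_norm,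
        Real.norm_of_nonneg (bump_pos _).le]
      exact mul_le_of_le_one_right (by positivity) (bump_mul_norm_le _))
    (integrable_const _)
    (.of_forall fun y x _ => hasFDerivAt_bump_displacement t x y)
  refine h.congr_fderiv ?_
  rw [integral_smul, firstMoment, ← ContinuousLinearMap.integral_comp_comm _
    (integrable_bump_smul μ t x)]
  simp

lemma hasFDerivAt_firstMoment :
    HasFDerivAt (firstMoment μ t)
      ((√t)⁻¹ • (secondMoment μ t x - mass μ t x • ContinuousLinearMap.id ℝ (E d))) x := by
  have h := hasFDerivAt_integral_of_dominated_of_fderiv_le (𝕜 := ℝ) (μ := μ) (s := Set.univ)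
    (F := fun x y => bump (displacement t x y) • displacement t x y)
    (F' := fun x y => (√t)⁻¹ • (bump (displacement t x y) •
          rankOne ℝ (displacement t x y) (displacement t x y)
        - bump (displacement t x y) • ContinuousLinearMap.id ℝ (E d)))
    (x₀ := x) (bound := fun _ => (√t)⁻¹ * 2) Filter.univ_mem
    (.of_forall fun x => (continuous_bump_smul t x).aestronglyMeasurable)
    (integrable_bump_smul μ t x)
    (by
      refine Continuous.aestronglyMeasurable ?_
      exact ((continuous_bump_smul_rankOne t x).sub
        ((continuous_bump_displacement t x).smul continuous_const)).const_smul (√t)⁻¹)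
    (.of_forall fun y x _ => by
      rw [norm_smul, Real.norm_of_nonneg (by positivity)]
      refine mul_le_mul_of_nonneg_left ?_ (by positivity)
      refine (norm_sub_le _ _).trans ?_
      rw [norm_bump_smul_rankOne, norm_smul, Real.norm_of_nonneg (bump_pos _).le]
      have h1 := bump_mul_norm_sq_le (displacement t x y)
      have h2 := mul_le_one₀ (bump_le_one (displacement t x y)) (norm_nonneg _)
        (ContinuousLinearMap.norm_id_le (𝕜 := ℝ) (E := E d))
      linarith)
    (integrable_const _)
    (.of_forall fun y x _ => hasFDerivAt_bump_smul_displacement t x y)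
  refine h.congr_fderiv ?_
  rw [integral_smul, integral_sub (integrable_bump_smul_rankOne μ t x)
    ((integrable_bump μ t x).smul_const _), integral_smul_const, secondMoment, mass]

end Derivatives

end Kernel

/-! ### Closed forms for the score, the estimator and their Jacobians. -/

section Scores

variable {d : ℕ} {t : ℝ}

lemma gaussianKernel_sub (ht : 0 < t) (x y : E d) :
    gaussianKernel t (y - x)
      = 1 / (2 * Real.pi * t) ^ ((d : ℝ) / 2) * bump (displacement t x y) := by
  rw [gaussianKernel, bump, displacement, norm_smul, mul_pow, norm_inv,
    Real.norm_of_nonneg (Real.sqrt_nonneg t), inv_pow, Real.sq_sqrt ht.le]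
  congr 2
  field_simp

lemma diffusedDensity_eq_mass (μ : Measure (E d)) (ht : 0 < t) :
    diffusedDensity μ t
      = fun x => 1 / (2 * Real.pi * t) ^ ((d : ℝ) / 2) * mass μ t x := by
  ext x
  simp only [diffusedDensity, gaussianKernel_sub ht, integral_const_mul, mass]

lemma hasGradientAt_diffusedDensity (μ : Measure (E d)) [IsProbabilityMeasure μ] (ht : 0 < t)
    (x : E d) :
    HasGradientAt (diffusedDensity μ t)
      ((1 / (2 * Real.pi * t) ^ ((d : ℝ) / 2)) • (√t)⁻¹ • firstMoment μ t x) x := by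
  rw [hasGradientAt_iff_hasFDerivAt, diffusedDensity_eq_mass μ ht]
  refine ((hasFDerivAt_mass μ t x).const_mul _).congr_fderiv ?_
  ext v
  simp

lemma score_eq (μ : Measure (E d)) [IsProbabilityMeasure μ] (ht : 0 < t) :
    score μ t = fun x => (mass μ t x)⁻¹ • (√t)⁻¹ • firstMoment μ t x := by
  ext1 x
  have hc : 0 < 1 / (2 * Real.pi * t) ^ ((d : ℝ) / 2) := by positivity
  have hP := mass_pos μ t x
  have hpos : diffusedDensity μ t x ≠ 0 := by
    rw [diffusedDensity_eq_mass μ ht]; positivity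
  rw [score]
  refine HasGradientAt.gradient ?_
  rw [hasGradientAt_iff_hasFDerivAt]
  refine ((hasGradientAt_iff_hasFDerivAt.1
    (hasGradientAt_diffusedDensity μ ht x)).log hpos).congr_fderiv ?_
  rw [diffusedDensity_eq_mass μ ht]
  ext v
  simp only [smul_apply, InnerProductSpace.toDual_apply_apply, inner_smul_left, smul_eq_mul,
    conj_trivial]
  field_simp

/-- The Jacobian `J_t` of the score of `μ`, in units of `1 / t`. -/
def scaledJacobian (μ : Measure (E d)) (t : ℝ) (x : E d) : E d →L[ℝ] E d :=
  (mass μ t x)⁻¹ • secondMoment μ t x - ContinuousLinearMap.id ℝ (E d)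
    - ((mass μ t x)⁻¹ ^ 2) • rankOne ℝ (firstMoment μ t x) (firstMoment μ t x)

/-- A general radial factor `φ` treats both fields at once: `φ v = v⁻¹` gives the score, and the
cutoff divided by `v` gives the estimator. -/
lemma hasFDerivAt_comp_mass_smul_firstMoment (μ : Measure (E d)) [IsProbabilityMeasure μ]
    (ht : 0 < t) (x : E d) {φ : ℝ → ℝ} {φ' : ℝ} (hφ : HasDerivAt φ φ' (mass μ t x)) :
    HasFDerivAt (fun x => φ (mass μ t x) • (√t)⁻¹ • firstMoment μ t x)
      ((1 / t) • (φ (mass μ t x) •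
          (secondMoment μ t x - mass μ t x • ContinuousLinearMap.id ℝ (E d))
        + φ' • rankOne ℝ (firstMoment μ t x) (firstMoment μ t x))) x := by
  have h1 := hφ.comp_hasFDerivAt x (hasFDerivAt_mass μ t x)
  refine (h1.smul ((hasFDerivAt_firstMoment μ t x).const_smul (√t)⁻¹)).congr_fderiv ?_
  have hs : 1 / t = (√t)⁻¹ * (√t)⁻¹ := by
    rw [← mul_inv, Real.mul_self_sqrt ht.le, one_div]
  rw [hs]
  ext1 v
  simp only [add_apply, smul_apply, sub_apply, ContinuousLinearMap.smulRight_apply,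
    InnerProductSpace.rankOne_apply, innerSL_apply_apply, ContinuousLinearMap.id_apply,
    smul_eq_mul, Function.comp_apply, Pi.smul_apply]
  module

lemma hasFDerivAt_score (μ : Measure (E d)) [IsProbabilityMeasure μ] (ht : 0 < t) (x : E d) :
    HasFDerivAt (score μ t) ((1 / t) • scaledJacobian μ t x) x := by
  rw [score_eq μ ht]
  have hP := (mass_pos μ t x).ne'
  refine (hasFDerivAt_comp_mass_smul_firstMoment μ ht x (hasDerivAt_inv hP)).congr_fderiv ?_
  rw [scaledJacobian, smul_sub, smul_smul (mass μ t x)⁻¹, inv_mul_cancel₀ hP, one_smul,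
    neg_smul, ← sub_eq_add_neg, inv_pow]

/-- The empirical measure of a finite sample. -/
def empirical {n : ℕ} (X : Fin n → E d) : Measure (E d) :=
  ENNReal.ofReal (1 / n) • ∑ i, Measure.dirac (X i)

lemma isProbabilityMeasure_empirical {n : ℕ} (hn : n ≠ 0) (X : Fin n → E d) :
    IsProbabilityMeasure (empirical X) := by
  constructor
  simp only [empirical, Measure.smul_apply, Measure.coe_finsetSum, Finset.sum_apply,
    measure_univ, Finset.sum_const, Finset.card_univ, Fintype.card_fin, nsmul_eq_mul, mul_one,
    smul_eq_mul]
  rw [← ENNReal.ofReal_natCast, ← ENNReal.ofReal_mul (by positivity)]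
  have : (n : ℝ) ≠ 0 := by exact_mod_cast hn
  rw [one_div_mul_cancel this, ENNReal.ofReal_one]

lemma integral_empirical {n : ℕ} (X : Fin n → E d) {F : Type*} [NormedAddCommGroup F]
    [NormedSpace ℝ F] [CompleteSpace F] (f : E d → F) :
    ∫ y, f y ∂empirical X = (1 / n : ℝ) • ∑ i, f (X i) := by
  rw [empirical, integral_smul_measure, ENNReal.toReal_ofReal (by positivity),
    integral_finsetSum_measure fun i _ => integrable_dirac (by simp)]
  simp

/-- Lets every moment identity and bound proved for a probability measure apply to the data as well.
-/
lemma densityEstimator_eq_diffusedDensity {n : ℕ} (X : Fin n → E d) (t : ℝ) :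
    densityEstimator X t = diffusedDensity (empirical X) t := by
  ext x
  rw [densityEstimator, diffusedDensity, integral_empirical, smul_eq_mul]

/-- Identifies the cutoff with a known smooth function, which settles its regularity, including at
the two gluing points. -/
lemma softThreshold_eq_smoothTransition {η : ℝ} (hη : 0 < η) (x : ℝ) :
    softThreshold η x = Real.smoothTransition (2 * x / η - 1) := by
  unfold softThreshold
  split_ifs with h1 h2
  · rw [Real.smoothTransition.one_of_one_le]
    have : 2 ≤ 2 * x / η := by rw [le_div_iff₀ hη]; linarith
    linarith
  · rw [Real.smoothTransition.zero_of_nonpos]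
    have : 2 * x / η ≤ 1 := by rw [div_le_iff₀ hη]; linarith
    linarith
  · push Not at h1 h2
    have hu0 : 0 < 2 * x / η - 1 := by rw [sub_pos, lt_div_iff₀ hη]; linarith
    have hu1 : 2 * x / η < 2 := by rw [div_lt_iff₀ hη]; linarith
    have e : (2 - 2 * x / η) = 1 - (2 * x / η - 1) := by ring
    rw [e]
    have hu1' : 0 < 1 - (2 * x / η - 1) := by linarith
    generalize 2 * x / η - 1 = u at *
    rw [Real.smoothTransition, expNegInvGlue, expNegInvGlue, if_neg hu0.not_ge,
      if_neg hu1'.not_ge]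
    have : (1 - 2 * u) / (u * (1 - u)) = -(1 - u)⁻¹ - -u⁻¹ := by
      field_simp; ring
    rw [this, Real.exp_sub]
    field_simp

lemma threshold_eq (d n : ℕ) (t : ℝ) :
    threshold d n t
      = 1 / (2 * Real.pi * t) ^ ((d : ℝ) / 2) * (Real.log n / n) := by
  rw [threshold]
  field_simp

/-- The factor `(2πt)^(-d/2)` occurs in the density, its gradient and the threshold, so it cancels;
the threshold on the mass is `log n / n` for every `d` and `t`. -/
lemma scoreEstimator_eq {n : ℕ} (hn : 2 ≤ n) (X : Fin n → E d) (ht : 0 < t) :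
    scoreEstimator X t = fun x =>
      (Real.smoothTransition (2 * mass (empirical X) t x / (Real.log n / n) - 1)
        / mass (empirical X) t x) • (√t)⁻¹ • firstMoment (empirical X) t x := by
  have := isProbabilityMeasure_empirical (by omega) X
  ext1 x
  have hc : 0 < 1 / (2 * Real.pi * t) ^ ((d : ℝ) / 2) := by positivity
  have hL : 0 < Real.log n / n := by
    have := Real.log_pos (x := n) (by exact_mod_cast hn)
    positivity
  have hη : 0 < threshold d n t := by rw [threshold_eq]; positivity
  rw [scoreEstimator, softThreshold_eq_smoothTransition hη, densityEstimator_eq_diffusedDensity,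
    (hasGradientAt_diffusedDensity (empirical X) ht x).gradient, threshold_eq,
    diffusedDensity_eq_mass _ ht]
  simp only []
  generalize 1 / (2 * Real.pi * t) ^ ((d : ℝ) / 2) = c at *
  have hP := (mass_pos (empirical X) t x)
  rw [show 2 * (c * mass (empirical X) t x) / (c * (Real.log n / n))
      = 2 * mass (empirical X) t x / (Real.log n / n) by
    rw [mul_left_comm, mul_div_mul_left _ _ hc.ne'], smul_smul]
  congr 1
  field_simp

/-- The Jacobian of the score estimator with data distribution `μ`, in units of `1 / t`;
`η` is the threshold for the Gaussian average. -/
def thresholdedJacobian (μ : Measure (E d)) (t η : ℝ) (x : E d) : E d →L[ℝ] E d :=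
  Real.smoothTransition (2 * mass μ t x / η - 1) • scaledJacobian μ t x
    + (deriv Real.smoothTransition (2 * mass μ t x / η - 1) * (2 * mass μ t x / η)) •
      (((mass μ t x)⁻¹ ^ 2) • rankOne ℝ (firstMoment μ t x) (firstMoment μ t x))

lemma hasFDerivAt_scoreEstimator {n : ℕ} (hn : 2 ≤ n) (X : Fin n → E d) (ht : 0 < t)
    (x : E d) :
    HasFDerivAt (scoreEstimator X t)
      ((1 / t) • thresholdedJacobian (empirical X) t (Real.log n / n) x) x := by
  have := isProbabilityMeasure_empirical (by omega) X
  rw [scoreEstimator_eq hn X ht]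
  have hP := (mass_pos (empirical X) t x).ne'
  set η := Real.log n / n
  set u := mass (empirical X) t x with hu
  have hT : HasDerivAt Real.smoothTransition
      (deriv Real.smoothTransition (2 * u / η - 1)) (2 * u / η - 1) :=
    ((Real.smoothTransition.contDiff (n := 1)).differentiable (by simp) _).hasDerivAt
  have h1 : HasDerivAt (fun v : ℝ => 2 * v / η - 1) (2 / η) u := by
    simpa using (((hasDerivAt_id u).const_mul 2).div_const η).sub_const 1
  have h2 := (hT.comp u h1).div (hasDerivAt_id u) hP
  refine (hasFDerivAt_comp_mass_smul_firstMoment (empirical X) ht x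
    (φ := fun v => Real.smoothTransition (2 * v / η - 1) / v) h2).congr_fderiv ?_
  rw [thresholdedJacobian, scaledJacobian, ← hu]
  congr 1
  simp only [Function.comp_apply, id, mul_one]
  set T := Real.smoothTransition (2 * u / η - 1)
  set T' := deriv Real.smoothTransition (2 * u / η - 1)
  have e1 : (T' * (2 / η) * u - T) / u ^ 2 = T' * (2 * u / η) * u⁻¹ ^ 2 - T * u⁻¹ ^ 2 := by
    field_simp
  have e2 : T / u * u = T := by field_simp
  rw [e1, smul_sub, smul_smul, e2, div_eq_mul_inv]
  module

end Scores

/-- Such points are global extrema of a function with values in `[0, 1]`. -/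
lemma deriv_smoothTransition_eq_zero {u : ℝ} (hu : u ≤ 0 ∨ 1 ≤ u) :
    deriv Real.smoothTransition u = 0 := by
  rcases hu with hu | hu
  · refine IsLocalMin.deriv_eq_zero (.of_forall fun v => ?_)
    rw [Real.smoothTransition.zero_of_nonpos hu]
    exact Real.smoothTransition.nonneg v
  · refine IsLocalMax.deriv_eq_zero (.of_forall fun v => ?_)
    rw [Real.smoothTransition.one_of_one_le hu]
    exact Real.smoothTransition.le_one v

lemma exists_abs_deriv_smoothTransition_le :
    ∃ b : ℝ, 0 ≤ b ∧ ∀ u, |deriv Real.smoothTransition u| ≤ b := by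
  have hc : Continuous (deriv Real.smoothTransition) :=
    (Real.smoothTransition.contDiff (n := 1)).continuous_deriv (by simp)
  obtain ⟨b, hb⟩ := (isCompact_Icc (a := (0 : ℝ)) (b := 1)).exists_bound_of_continuousOn
    hc.continuousOn
  have hb0 : 0 ≤ b := (norm_nonneg _).trans (hb 0 (by simp))
  refine ⟨b, hb0, fun u => ?_⟩
  by_cases hu : u ∈ Set.Icc (0 : ℝ) 1
  · exact hb u hu
  · rw [deriv_smoothTransition_eq_zero, abs_zero]
    · exact hb0
    · by_contra! h
      exact hu ⟨h.1.le, h.2.le⟩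

/-! ### Deterministic size and stability of the Jacobians. -/

section Bounds

variable {d : ℕ} (μ ν : Measure (E d)) (t : ℝ) (x : E d)

/-- Writes the quadratic term through the ratio `a/P`, so stability only has to be shown for
quotients. -/
lemma mass_inv_sq_smul_rankOne :
    ((mass μ t x)⁻¹ ^ 2) • rankOne ℝ (firstMoment μ t x) (firstMoment μ t x)
      = rankOne ℝ ((mass μ t x)⁻¹ • firstMoment μ t x) ((mass μ t x)⁻¹ • firstMoment μ t x) := by
  ext1 v
  simp only [smul_apply, InnerProductSpace.rankOne_apply, inner_smul_left, conj_trivial]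
  module

lemma thresholdedJacobian_of_le {η : ℝ} (hη : 0 < η) (h : η ≤ mass μ t x) :
    thresholdedJacobian μ t η x = scaledJacobian μ t x := by
  have h1 : 1 ≤ 2 * mass μ t x / η - 1 := by
    have : 2 ≤ 2 * mass μ t x / η := by rw [le_div_iff₀ hη]; linarith
    linarith
  rw [thresholdedJacobian, Real.smoothTransition.one_of_one_le h1,
    deriv_smoothTransition_eq_zero (Or.inr h1)]
  simp

variable [IsProbabilityMeasure μ] [IsProbabilityMeasure ν]

lemma norm_mass_inv_smul_secondMoment_le :
    ‖(mass μ t x)⁻¹ • secondMoment μ t x‖ ≤ 2 * logMass μ t x := by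
  have hP := mass_pos μ t x
  rw [norm_smul, norm_inv, Real.norm_of_nonneg hP.le, inv_mul_le_iff₀ hP]
  linarith [norm_secondMoment_le μ t x]

lemma norm_mass_inv_smul_firstMoment_le :
    ‖(mass μ t x)⁻¹ • firstMoment μ t x‖ ≤ 2 * √(logMass μ t x) := by
  have hP := mass_pos μ t x
  rw [norm_smul, norm_inv, Real.norm_of_nonneg hP.le, inv_mul_le_iff₀ hP]
  linarith [norm_firstMoment_le μ t x]

lemma norm_mass_inv_sq_smul_rankOne_le :
    ‖((mass μ t x)⁻¹ ^ 2) • rankOne ℝ (firstMoment μ t x) (firstMoment μ t x)‖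
      ≤ 4 * logMass μ t x := by
  rw [mass_inv_sq_smul_rankOne, InnerProductSpace.norm_rankOne]
  have h := norm_mass_inv_smul_firstMoment_le μ t x
  have hsq : √(logMass μ t x) ^ 2 = logMass μ t x :=
    Real.sq_sqrt (zero_le_one.trans (one_le_logMass μ t x))
  nlinarith [mul_self_le_mul_self (norm_nonneg _) h]

lemma norm_scaledJacobian_le : ‖scaledJacobian μ t x‖ ≤ 7 * logMass μ t x := by
  have h1 := norm_mass_inv_smul_secondMoment_le μ t x
  have h2 := norm_mass_inv_sq_smul_rankOne_le μ t x
  have h3 := ContinuousLinearMap.norm_id_le (𝕜 := ℝ) (E := E d)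
  have h4 := one_le_logMass μ t x
  refine (norm_sub_le _ _).trans ?_
  have := norm_sub_le ((mass μ t x)⁻¹ • secondMoment μ t x) (ContinuousLinearMap.id ℝ (E d))
  linarith

lemma logMass_le {q : ℝ} (hq : 0 < q) (h : q ≤ mass μ t x) :
    logMass μ t x ≤ 1 + Real.log (1 / q) := by
  unfold logMass
  have := mass_pos μ t x
  gcongr

lemma norm_thresholdedJacobian_le {b η : ℝ} (hη : 0 < η) (hη1 : η ≤ 2)
    (hb : ∀ u, |deriv Real.smoothTransition u| ≤ b) :
    ‖thresholdedJacobian μ t η x‖ ≤ (7 + 8 * b) * (1 + Real.log (2 / η)) := by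
  have hb0 : 0 ≤ b := (abs_nonneg _).trans (hb 0)
  have hP := mass_pos μ t x
  have hlog : 0 ≤ Real.log (2 / η) := Real.log_nonneg (by rw [le_div_iff₀ hη]; linarith)
  rcases le_or_gt (mass μ t x) (η / 2) with h | h
  · have h1 : 2 * mass μ t x / η - 1 ≤ 0 := by
      have : 2 * mass μ t x / η ≤ 1 := by rw [div_le_iff₀ hη]; linarith
      linarith
    rw [thresholdedJacobian, Real.smoothTransition.zero_of_nonpos h1,
      deriv_smoothTransition_eq_zero (Or.inl h1)]
    have : 0 ≤ (7 + 8 * b) * (1 + Real.log (2 / η)) := by positivity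
    rw [zero_mul, zero_smul ℝ (scaledJacobian μ t x), zero_add,
      zero_smul ℝ ((mass μ t x)⁻¹ ^ 2 • _), norm_zero]
    exact this
  · have hl : logMass μ t x ≤ 1 + Real.log (2 / η) := by
      have := logMass_le μ t x (q := η / 2) (by positivity) h.le
      rwa [one_div_div] at this
    have hl1 := one_le_logMass μ t x
    have hT0 := Real.smoothTransition.nonneg (2 * mass μ t x / η - 1)
    have hT1 := Real.smoothTransition.le_one (2 * mass μ t x / η - 1)
    -- The derivative lives where `mass < η`, and there the otherwise unbounded factor `2 * mass /
    -- η` is below 2.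
    have hD : |deriv Real.smoothTransition (2 * mass μ t x / η - 1) * (2 * mass μ t x / η)|
        ≤ b * 2 := by
      rcases le_or_gt 1 (2 * mass μ t x / η - 1) with h1 | h1
      · rw [deriv_smoothTransition_eq_zero (Or.inr h1), zero_mul, abs_zero]
        positivity
      · have h0 : 0 ≤ 2 * mass μ t x / η := by positivity
        rw [abs_mul, abs_of_nonneg h0]
        exact mul_le_mul (hb _) (by linarith) h0 hb0
    calc ‖thresholdedJacobian μ t η x‖ ≤ 1 * (7 * logMass μ t x)
          + b * 2 * (4 * logMass μ t x) := by
          refine (norm_add_le _ _).trans (add_le_add ?_ ?_)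
          · rw [norm_smul, Real.norm_of_nonneg hT0]
            exact mul_le_mul hT1 (norm_scaledJacobian_le μ t x) (norm_nonneg _) zero_le_one
          · rw [norm_smul]
            exact mul_le_mul hD (norm_mass_inv_sq_smul_rankOne_le μ t x) (norm_nonneg _)
              (by positivity)
      _ = (7 + 8 * b) * logMass μ t x := by ring
      _ ≤ _ := by gcongr

/-- Rests on `a/q - b/p = q⁻¹ ((a - b) - (q - p)(b/p))`, which asks for a bound on the ratio `b/p`
only. -/
lemma norm_inv_smul_sub_inv_smul_le {F : Type*} [NormedAddCommGroup F] [NormedSpace ℝ F]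
    {p q m : ℝ} {a b : F} (hp : 0 < p) (hq : p / 2 ≤ q) (hb : ‖p⁻¹ • b‖ ≤ m) :
    ‖q⁻¹ • a - p⁻¹ • b‖ ≤ 2 / p * (‖a - b‖ + m * |q - p|) := by
  have hq0 : 0 < q := by linarith
  have hqi : q⁻¹ ≤ 2 / p := by
    rw [inv_le_comm₀ hq0 (by positivity), inv_div]; exact hq
  have e : q⁻¹ • a - p⁻¹ • b = q⁻¹ • ((a - b) - (q - p) • p⁻¹ • b) := by
    have : q⁻¹ * (q - p) * p⁻¹ = p⁻¹ - q⁻¹ := by field_simp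
    rw [smul_sub, smul_sub, smul_smul, smul_smul, this]
    module
  rw [e, norm_smul, Real.norm_of_nonneg (inv_nonneg.2 hq0.le)]
  refine mul_le_mul hqi ?_ (norm_nonneg _) (by positivity)
  refine (norm_sub_le _ _).trans (add_le_add le_rfl ?_)
  rw [norm_smul, Real.norm_eq_abs, mul_comm]
  exact mul_le_mul_of_nonneg_right hb (abs_nonneg _)

lemma norm_rankOne_self_sub_le (a b : E d) :
    ‖rankOne ℝ a a - rankOne ℝ b b‖ ≤ (‖a‖ + ‖b‖) * ‖a - b‖ := by
  have e : rankOne ℝ a a - rankOne ℝ b b = rankOne ℝ a (a - b) + rankOne ℝ (a - b) b := by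
    simp
  rw [e]
  refine (norm_add_le _ _).trans (le_of_eq ?_)
  simp only [InnerProductSpace.norm_rankOne]
  ring

/-- The total deviation of the Gaussian moments of two measures at a point. -/
def momentGap : ℝ :=
  |mass ν t x - mass μ t x| + ‖firstMoment ν t x - firstMoment μ t x‖
    + ‖secondMoment ν t x - secondMoment μ t x‖

lemma norm_scaledJacobian_sub_le (h : mass μ t x / 2 ≤ mass ν t x) :
    ‖scaledJacobian ν t x - scaledJacobian μ t x‖
      ≤ 24 * logMass μ t x * (momentGap μ ν t x / mass μ t x) := by
  have hP := mass_pos μ t x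
  have hl := one_le_logMass μ t x
  have hlν : logMass ν t x ≤ 2 * logMass μ t x := by
    have h1 := logMass_le ν t x (by positivity) h
    rw [one_div_div, ← mul_one_div, Real.log_mul two_ne_zero (by positivity)] at h1
    have : Real.log 2 ≤ 1 := by linarith [Real.log_two_lt_d9]
    unfold logMass at hl h1 ⊢
    linarith
  have hsq : √(logMass μ t x) ^ 2 = logMass μ t x := Real.sq_sqrt (by linarith)
  have hsq1 : 1 ≤ √(logMass μ t x) := Real.one_le_sqrt.2 hl
  -- Halving the mass adds at most `log 2 ≤ 1` to `logMass`, hence at most doubles it, and `√2 ≤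
  -- 3/2`.
  have hsν : √(logMass ν t x) ≤ 3 / 2 * √(logMass μ t x) := by
    rw [Real.sqrt_le_left (by positivity), mul_pow, hsq]
    linarith
  have hB := norm_inv_smul_sub_inv_smul_le (a := secondMoment ν t x) hP h
    (norm_mass_inv_smul_secondMoment_le μ t x)
  have ha := norm_inv_smul_sub_inv_smul_le (a := firstMoment ν t x) hP h
    (norm_mass_inv_smul_firstMoment_le μ t x)
  have hα := norm_mass_inv_smul_firstMoment_le μ t x
  have hβ := norm_mass_inv_smul_firstMoment_le ν t x
  have hr := norm_rankOne_self_sub_le ((mass ν t x)⁻¹ • firstMoment ν t x)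
    ((mass μ t x)⁻¹ • firstMoment μ t x)
  have e : scaledJacobian ν t x - scaledJacobian μ t x
      = ((mass ν t x)⁻¹ • secondMoment ν t x - (mass μ t x)⁻¹ • secondMoment μ t x)
        - (rankOne ℝ ((mass ν t x)⁻¹ • firstMoment ν t x) ((mass ν t x)⁻¹ • firstMoment ν t x)
          - rankOne ℝ ((mass μ t x)⁻¹ • firstMoment μ t x)
            ((mass μ t x)⁻¹ • firstMoment μ t x)) := by
    rw [scaledJacobian, scaledJacobian, mass_inv_sq_smul_rankOne, mass_inv_sq_smul_rankOne]
    abel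
  rw [e]
  refine (norm_sub_le _ _).trans ((add_le_add hB hr).trans ?_)
  set s := √(logMass μ t x)
  have hr2 : (‖(mass ν t x)⁻¹ • firstMoment ν t x‖ + ‖(mass μ t x)⁻¹ • firstMoment μ t x‖) *
      ‖(mass ν t x)⁻¹ • firstMoment ν t x - (mass μ t x)⁻¹ • firstMoment μ t x‖ ≤
      (5 * s) * (2 / mass μ t x * (‖firstMoment ν t x - firstMoment μ t x‖
        + 2 * s * |mass ν t x - mass μ t x|)) :=
    mul_le_mul (by linarith) ha (norm_nonneg _) (by positivity)
  refine (add_le_add le_rfl hr2).trans ?_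
  rw [← hsq, momentGap]
  set Δ₀ := |mass ν t x - mass μ t x|
  set Δ₁ := ‖firstMoment ν t x - firstMoment μ t x‖
  set Δ₂ := ‖secondMoment ν t x - secondMoment μ t x‖
  have h0 : 0 ≤ Δ₀ := abs_nonneg _
  have h1 : 0 ≤ Δ₁ := norm_nonneg _
  have h2 : 0 ≤ Δ₂ := norm_nonneg _
  have hss : s ≤ s ^ 2 := by nlinarith
  rw [show 2 / mass μ t x * (Δ₂ + 2 * s ^ 2 * Δ₀) + 5 * s * (2 / mass μ t x * (Δ₁ + 2 * s * Δ₀))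
      = 2 * (Δ₂ + 12 * s ^ 2 * Δ₀ + 5 * (s * Δ₁)) / mass μ t x by ring,
    ← mul_div_assoc]
  refine div_le_div_of_nonneg_right ?_ hP.le
  nlinarith [mul_le_mul_of_nonneg_right hss h1,
    mul_le_mul_of_nonneg_right (hsq1.trans hss) h2]

end Bounds

lemma half_lt_log {n : ℕ} (hn : 2 ≤ n) : 1 / 2 < Real.log n := by
  have h : Real.log 2 ≤ Real.log n := Real.log_le_log two_pos (by exact_mod_cast hn)
  linarith [Real.log_two_gt_d9]

lemma log_div_self_pos {n : ℕ} (hn : 2 ≤ n) : 0 < Real.log n / n := by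
  have := half_lt_log hn
  have : (0 : ℝ) < n := by positivity
  positivity

lemma log_div_self_le_one (n : ℕ) : Real.log n / n ≤ 1 := by
  rcases Nat.eq_zero_or_pos n with rfl | hn
  · simp
  · have : (0 : ℝ) < n := by exact_mod_cast hn
    rw [div_le_one this]
    linarith [Real.log_le_sub_one_of_pos this]

lemma one_add_log_two_div_le {n : ℕ} (hn : 2 ≤ n) :
    1 + Real.log (2 / (Real.log n / n)) ≤ 5 * Real.log n := by
  have hL := half_lt_log hn
  have hn0 : (0 : ℝ) < n := by positivity
  have h1 : 2 / (Real.log n / n) ≤ 2 ^ 2 * n := by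
    rw [div_div_eq_mul_div, div_le_iff₀ (by linarith)]
    nlinarith
  have h2 := Real.log_le_log (by have := log_div_self_pos hn; positivity) h1
  rw [Real.log_mul (by norm_num) hn0.ne', Real.log_pow] at h2
  have h3 : Real.log 2 ≤ Real.log n := Real.log_le_log two_pos (by exact_mod_cast hn)
  push_cast at h2
  linarith

/-- The deterministic comparison of the two Jacobians. -/
lemma exists_norm_thresholdedJacobian_sub_le :
    ∃ C : ℝ, 0 < C ∧ ∀ {d n : ℕ} (_ : 2 ≤ n) (μ ν : Measure (E d)) [IsProbabilityMeasure μ]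
      [IsProbabilityMeasure ν] (t : ℝ) (x : E d),
      ‖thresholdedJacobian ν t (Real.log n / n) x - scaledJacobian μ t x‖
          ≤ C * Real.log n * (momentGap μ ν t x / mass μ t x
            + (Real.log n / n / mass μ t x) ^ (3 / 4 : ℝ)) ∧
      ‖thresholdedJacobian ν t (Real.log n / n) x - scaledJacobian μ t x‖
          ≤ C * (Real.log n + logMass μ t x) := by
  obtain ⟨b, hb0, hb⟩ := exists_abs_deriv_smoothTransition_le
  refine ⟨10 * (7 + 8 * b) + 120, by positivity, ?_⟩
  intro d n hn μ ν _ _ t x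
  have hL := half_lt_log hn
  have hη := log_div_self_pos hn
  have hη1 := log_div_self_le_one n
  have hlogη := one_add_log_two_div_le hn
  set L := Real.log n
  set η := L / n
  have hP := mass_pos μ t x
  have hl := one_le_logMass μ t x
  have hT : ‖thresholdedJacobian ν t η x‖ ≤ (7 + 8 * b) * (5 * L) :=
    (norm_thresholdedJacobian_le ν t x hη (by linarith) hb).trans (by gcongr)
  have hcrude : ‖thresholdedJacobian ν t η x - scaledJacobian μ t x‖
      ≤ (7 + 8 * b) * (5 * L) + 7 * logMass μ t x :=
    (norm_sub_le _ _).trans (add_le_add hT (norm_scaledJacobian_le μ t x))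
  have hgap : |mass ν t x - mass μ t x| ≤ momentGap μ ν t x := by
    unfold momentGap
    linarith [norm_nonneg (firstMoment ν t x - firstMoment μ t x),
      norm_nonneg (secondMoment ν t x - secondMoment μ t x)]
  have hgap0 : 0 ≤ momentGap μ ν t x := (abs_nonneg _).trans hgap
  have hbL : 0 ≤ b * L := by positivity
  refine ⟨?_, by nlinarith⟩
  have hr0 : 0 ≤ (η / mass μ t x) ^ (3 / 4 : ℝ) := by positivity
  have hg0 : 0 ≤ momentGap μ ν t x / mass μ t x := by positivity
  -- If both `P ≥ 2η` and the other mass is at least `P/2`, that mass is at least `η` and the cutoff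
  -- is inactive. In each remaining case one error term is bounded below, so crude bounds suffice.
  rcases le_or_gt (2 * η) (mass μ t x) with h | h
  · have hlμ : logMass μ t x ≤ 5 * L := by
      refine (logMass_le μ t x (by positivity) h).trans (le_trans ?_ hlogη)
      have : 1 / (2 * η) ≤ 2 / η := by
        rw [div_le_div_iff₀ (by positivity) hη]; linarith
      gcongr
    rcases le_or_gt (mass μ t x / 2) (mass ν t x) with h2 | h2
    · rw [thresholdedJacobian_of_le ν t x hη (by linarith)]
      refine (norm_scaledJacobian_sub_le μ ν t x h2).trans ?_
      calc _ ≤ 24 * (5 * L) * (momentGap μ ν t x / mass μ t x) := by gcongr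
        _ ≤ (10 * (7 + 8 * b) + 120) * L * (momentGap μ ν t x / mass μ t x) := by
            refine mul_le_mul_of_nonneg_right ?_ hg0
            nlinarith
        _ ≤ _ := by
            refine mul_le_mul_of_nonneg_left ?_ (by positivity)
            linarith
    -- The other mass lies below `P/2`, so the gap alone exceeds `P/2`.
    · have h3 : 1 ≤ 2 * (momentGap μ ν t x / mass μ t x) := by
        rw [← mul_div_assoc, le_div_iff₀ hP]
        have := neg_abs_le (mass ν t x - mass μ t x)
        linarith
      calc _ ≤ ((7 + 8 * b) * 5 + 35) * L := by linarith
        _ ≤ ((7 + 8 * b) * 5 + 35) * L * (2 * (momentGap μ ν t x / mass μ t x)) :=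
            le_mul_of_one_le_right (by positivity) h3
        _ = ((7 + 8 * b) * 10 + 70) * L * (momentGap μ ν t x / mass μ t x) := by ring
        _ ≤ (10 * (7 + 8 * b) + 120) * L * (momentGap μ ν t x / mass μ t x) := by
            refine mul_le_mul_of_nonneg_right ?_ hg0
            nlinarith
        _ ≤ _ := by
            refine mul_le_mul_of_nonneg_left ?_ (by positivity)
            linarith
  · set y := η / mass μ t x with hy
    have hy0 : 0 < y := by positivity
    have hy1 : 1 / 2 ≤ y := by
      rw [hy, le_div_iff₀ hP]; linarith
    have hy2 : 1 ≤ 2 * y ^ (3 / 4 : ℝ) := by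
      have h1 : (1 / 2 : ℝ) ^ (3 / 4 : ℝ) ≤ y ^ (3 / 4 : ℝ) := by gcongr
      have h2 : (1 / 2 : ℝ) ^ (1 : ℝ) ≤ (1 / 2 : ℝ) ^ (3 / 4 : ℝ) :=
        Real.rpow_le_rpow_of_exponent_ge (by norm_num) (by norm_num) (by norm_num)
      rw [Real.rpow_one] at h2
      linarith
    -- An exponent below 1 is chosen so that Hölder with a Gaussian weight can control the
    -- corresponding negative moment of the mass; `3/4` later produces the `3/2` power of the rate.
    have hy3 : Real.log y ≤ y ^ (3 / 4 : ℝ) / (3 / 4) :=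
      Real.log_le_rpow_div hy0.le (by norm_num)
    have hlμ : logMass μ t x ≤ 5 * L + Real.log y := by
      have e : (1 / mass μ t x) = 1 / η * y := by rw [hy]; field_simp
      have h1 : Real.log (1 / η) ≤ Real.log (2 / η) := by gcongr; norm_num
      rw [logMass, e, Real.log_mul (by positivity) hy0.ne']
      linarith
    set z := y ^ (3 / 4 : ℝ)
    have hz0 : 0 < z := by linarith
    have hLz : z ≤ 2 * (L * z) := by nlinarith
    have hL2 : L ≤ 2 * (L * z) := by nlinarith
    calc _ ≤ ((7 + 8 * b) * 5 + 35) * L + 7 * (z / (3 / 4)) := by linarith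
      _ ≤ ((7 + 8 * b) * 5 + 35) * (2 * (L * z)) + 20 * (L * z) := by
          refine add_le_add (mul_le_mul_of_nonneg_left hL2 (by positivity)) ?_
          linarith
      _ ≤ (10 * (7 + 8 * b) + 120) * L * z := by nlinarith
      _ ≤ _ := by
          refine mul_le_mul_of_nonneg_left ?_ (by positivity)
          linarith

/-! ### Expected deviation of the empirical moments. -/

section Sampling

variable {d : ℕ}

/-- The Hilbert–Schmidt norm dominates the operator norm, and its square is a sum of scalar
variances. -/
lemma norm_le_sqrt_sum_sq (T : E d →L[ℝ] E d) :
    ‖T‖ ≤ √(∑ q : Fin d × Fin d, (T (EuclideanSpace.single q.2 1) q.1) ^ 2) := by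
  refine T.opNorm_le_bound (Real.sqrt_nonneg _) fun v => ?_
  have hv : T v = ∑ j, v j • T (EuclideanSpace.single j 1) := by
    conv_lhs => rw [← (EuclideanSpace.basisFun (Fin d) ℝ).sum_repr v]
    simp
  rw [EuclideanSpace.norm_eq, EuclideanSpace.norm_eq, ← Real.sqrt_mul (by positivity)]
  refine Real.sqrt_le_sqrt ?_
  rw [Fintype.sum_prod_type, Finset.sum_mul]
  refine Finset.sum_le_sum fun i _ => ?_
  have hi : T v i = ∑ j, T (EuclideanSpace.single j 1) i * v j := by
    rw [hv]
    simp [mul_comm]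
  rw [Real.norm_eq_abs, sq_abs, hi]
  refine (Finset.sum_mul_sq_le_sq_mul_sq _ _ _).trans (le_of_eq ?_)
  simp

lemma continuous_integral_empirical {n : ℕ} {f : E d → ℝ} (hf : Continuous f) :
    Continuous fun X : Fin n → E d => ∫ y, f y ∂empirical X := by
  simp only [integral_empirical]
  fun_prop

lemma abs_integral_le_of_forall_abs_le (μ : Measure (E d)) [IsProbabilityMeasure μ]
    {f : E d → ℝ} {c : ℝ} (hc : ∀ y, |f y| ≤ c) : |∫ y, f y ∂μ| ≤ c := by
  simpa using norm_integral_le_of_norm_le_const (μ := μ) (f := f) (.of_forall hc)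

variable (p : Measure (E d)) [IsProbabilityMeasure p]

lemma integrable_of_continuous_of_forall_abs_le {f : E d → ℝ} (hf : Continuous f) {c : ℝ}
    (hc : ∀ y, |f y| ≤ c) : Integrable f p :=
  Integrable.of_bound hf.aestronglyMeasurable c (.of_forall hc)

lemma integrable_sq_integral_empirical_sub {n : ℕ} (hn : n ≠ 0) {f : E d → ℝ}
    (hf : Continuous f) {c : ℝ} (hc : ∀ y, |f y| ≤ c) :
    Integrable (fun X : Fin n → E d => (∫ y, f y ∂empirical X - ∫ y, f y ∂p) ^ 2)
      (Measure.pi fun _ => p) := by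
  refine Integrable.of_bound (C := (2 * c) ^ 2)
    (((continuous_integral_empirical hf).sub continuous_const).pow 2).aestronglyMeasurable
    (.of_forall fun X => ?_)
  have := isProbabilityMeasure_empirical hn X
  have h1 := abs_le.1 (abs_integral_le_of_forall_abs_le (empirical X) hc)
  have h2 := abs_le.1 (abs_integral_le_of_forall_abs_le p hc)
  rw [norm_pow]
  refine pow_le_pow_left₀ (norm_nonneg _) ?_ 2
  rw [Real.norm_eq_abs, abs_le]
  constructor <;> linarith [h1.1, h1.2, h2.1, h2.2]

/-- The variance of an empirical mean. -/
lemma integral_sq_integral_empirical_sub_le {n : ℕ} (hn : n ≠ 0) {f : E d → ℝ}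
    (hf : Continuous f) {c : ℝ} (hc : ∀ y, |f y| ≤ c) :
    ∫ X : Fin n → E d, (∫ y, f y ∂empirical X - ∫ y, f y ∂p) ^ 2 ∂(Measure.pi fun _ => p)
      ≤ 1 / n * ∫ y, f y ^ 2 ∂p := by
  have hn0 : (n : ℝ) ≠ 0 := by exact_mod_cast hn
  have hfi := integrable_of_continuous_of_forall_abs_le p hf hc
  have hL2 : MemLp f 2 p := MemLp.of_bound hf.aestronglyMeasurable c (.of_forall hc)
  set Q : Measure (Fin n → E d) := Measure.pi fun _ => p
  have hmean : ∫ X, ∫ y, f y ∂empirical X ∂Q = ∫ y, f y ∂p := by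
    simp only [integral_empirical, smul_eq_mul]
    rw [integral_const_mul, integral_finsetSum]
    · have : ∀ i : Fin n, ∫ X, f (X i) ∂Q = ∫ y, f y ∂p := fun i =>
        integral_comp_eval (μ := fun _ : Fin n => p) hf.aestronglyMeasurable
      simp only [this, Finset.sum_const, Finset.card_univ, Fintype.card_fin, nsmul_eq_mul]
      field_simp
    · exact fun i _ => integrable_comp_eval (μ := fun _ : Fin n => p) hfi
  have hvar : Var[fun X => ∫ y, f y ∂empirical X; Q] = 1 / n * Var[f; p] := by
    have h := variance_sum_pi (μ := fun _ : Fin n => p) (X := fun _ => f) fun _ => hL2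
    have e : (fun X : Fin n → E d => ∫ y, f y ∂empirical X)
        = fun X => (1 / n : ℝ) * (∑ i : Fin n, fun X : Fin n → E d => f (X i)) X := by
      ext X
      simp [integral_empirical]
    rw [e, variance_const_mul, h]
    simp only [Finset.sum_const, Finset.card_univ, Fintype.card_fin, nsmul_eq_mul]
    field_simp
  rw [variance_eq_integral (continuous_integral_empirical hf).aemeasurable, hmean] at hvar
  rw [hvar]
  gcongr
  exact variance_le_expectation_sq hf.aestronglyMeasurable

/-- Jensen for the square root, read off from nonnegativity of the variance of `√Y`. -/
lemma integral_sqrt_le_sqrt_integral {Ω : Type*} [MeasurableSpace Ω] (Q : Measure Ω)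
    [IsProbabilityMeasure Q] {Y : Ω → ℝ} (hY : Integrable Y Q) (hY0 : ∀ ω, 0 ≤ Y ω) :
    Integrable (fun ω => √(Y ω)) Q ∧ ∫ ω, √(Y ω) ∂Q ≤ √(∫ ω, Y ω ∂Q) := by
  have hm : AEStronglyMeasurable (fun ω => √(Y ω)) Q :=
    Real.continuous_sqrt.comp_aestronglyMeasurable hY.1
  have hL2 : MemLp (fun ω => √(Y ω)) 2 Q := by
    rw [memLp_two_iff_integrable_sq hm]
    simpa only [Real.sq_sqrt (hY0 _)] using hY
  refine ⟨hL2.integrable one_le_two, Real.le_sqrt_of_sq_le ?_⟩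
  have h := variance_nonneg (fun ω => √(Y ω)) Q
  rw [variance_eq_sub hL2] at h
  simp only [Pi.pow_apply, Real.sq_sqrt (hY0 _)] at h
  linarith

/-- The mean `ℓ²` deviation of a vector of empirical means. -/
lemma lintegral_sqrt_sum_sq_integral_empirical_sub_le {n : ℕ} (hn : n ≠ 0) {ι : Type*}
    [Fintype ι] {f : ι → E d → ℝ} (hf : ∀ j, Continuous (f j)) {c : ℝ}
    (hc : ∀ j y, |f j y| ≤ c) {g : E d → ℝ} (hg : Integrable g p)
    (hfg : ∀ y, ∑ j, f j y ^ 2 ≤ g y) :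
    ∫⁻ X : Fin n → E d, ENNReal.ofReal
        √(∑ j, (∫ y, f j y ∂empirical X - ∫ y, f j y ∂p) ^ 2) ∂(Measure.pi fun _ => p)
      ≤ ENNReal.ofReal √(1 / n * ∫ y, g y ∂p) := by
  have hint := fun j => integrable_sq_integral_empirical_sub p hn (hf j) (hc j)
  have hsq : ∀ j, Integrable (fun y => f j y ^ 2) p := fun j =>
    integrable_of_continuous_of_forall_abs_le p ((hf j).pow 2) (c := c ^ 2) fun y => by
      rw [abs_pow]; exact pow_le_pow_left₀ (abs_nonneg _) (hc j y) 2
  obtain ⟨h1, h2⟩ := integral_sqrt_le_sqrt_integral (Measure.pi fun _ : Fin n => p)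
    (integrable_finsetSum Finset.univ fun j _ => hint j)
    (fun X => Finset.sum_nonneg fun j _ => sq_nonneg _)
  rw [← ofReal_integral_eq_lintegral_ofReal h1 (.of_forall fun _ => Real.sqrt_nonneg _)]
  refine ENNReal.ofReal_le_ofReal (h2.trans (Real.sqrt_le_sqrt ?_))
  rw [integral_finsetSum _ fun j _ => hint j]
  calc _ ≤ ∑ j, 1 / n * ∫ y, f j y ^ 2 ∂p :=
        Finset.sum_le_sum fun j _ => integral_sq_integral_empirical_sub_le p hn (hf j) (hc j)
    _ = 1 / n * ∫ y, ∑ j, f j y ^ 2 ∂p := by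
        rw [integral_finsetSum _ fun j _ => hsq j, Finset.mul_sum]
    _ ≤ _ := by
        refine mul_le_mul_of_nonneg_left ?_ (by positivity)
        exact integral_mono (integrable_finsetSum _ fun j _ => hsq j) hg hfg

lemma firstMoment_apply (μ : Measure (E d)) [IsProbabilityMeasure μ] (t : ℝ) (x : E d)
    (j : Fin d) :
    firstMoment μ t x j = ∫ y, bump (displacement t x y) * displacement t x y j ∂μ := by
  have := (EuclideanSpace.proj (𝕜 := ℝ) j).integral_comp_comm (integrable_bump_smul μ t x)
  simpa [firstMoment] using this.symm

lemma secondMoment_single_apply (μ : Measure (E d)) [IsProbabilityMeasure μ] (t : ℝ) (x : E d)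
    (i j : Fin d) :
    secondMoment μ t x (EuclideanSpace.single j 1) i
      = ∫ y, bump (displacement t x y) * (displacement t x y i * displacement t x y j) ∂μ := by
  have h := integrable_bump_smul_rankOne μ t x
  have h2 := (EuclideanSpace.proj (𝕜 := ℝ) i).integral_comp_comm
    (h.apply_continuousLinearMap (EuclideanSpace.single j 1))
  rw [secondMoment, ContinuousLinearMap.integral_apply h]
  refine Eq.trans h2.symm (integral_congr_ae (.of_forall fun y => ?_))
  have hj : inner ℝ (displacement t x y) (EuclideanSpace.single j (1 : ℝ))
      = displacement t x y j := by
    rw [EuclideanSpace.inner_single_right]; simp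
  simp [hj, mul_comm]

lemma sum_sq_bump_mul (w : E d) : ∑ j, (bump w * w j) ^ 2 = bump w ^ 2 * ‖w‖ ^ 2 := by
  simp only [mul_pow, ← Finset.mul_sum, EuclideanSpace.real_norm_sq_eq]

lemma sum_sq_bump_mul_mul (w : E d) :
    ∑ q : Fin d × Fin d, (bump w * (w q.1 * w q.2)) ^ 2 = bump w ^ 2 * ‖w‖ ^ 4 := by
  rw [show ‖w‖ ^ 4 = ‖w‖ ^ 2 * ‖w‖ ^ 2 by ring, EuclideanSpace.real_norm_sq_eq,
    Finset.sum_mul_sum, Fintype.sum_prod_type]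
  simp only [mul_pow, Finset.mul_sum]

variable (t : ℝ) (x : E d)

lemma lintegral_abs_mass_empirical_sub_le {n : ℕ} (hn : n ≠ 0) :
    ∫⁻ X : Fin n → E d, ENNReal.ofReal |mass (empirical X) t x - mass p t x|
        ∂(Measure.pi fun _ => p) ≤ ENNReal.ofReal √(1 / n * mass p t x) := by
  have h := lintegral_sqrt_sum_sq_integral_empirical_sub_le p hn (ι := Unit)
    (f := fun _ y => bump (displacement t x y)) (g := fun y => bump (displacement t x y))
    (fun _ => continuous_bump_displacement t x) (c := 1)
    (fun _ y => by rw [abs_of_pos (bump_pos _)]; exact bump_le_one _)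
    (integrable_bump p t x)
    (fun y => by
      have h1 := bump_le_one (displacement t x y)
      have h0 := bump_pos (displacement t x y)
      simp only [Finset.univ_unique, Finset.sum_singleton]
      nlinarith)
  simpa only [Finset.univ_unique, Finset.sum_singleton, Real.sqrt_sq_eq_abs, mass] using h

lemma lintegral_norm_firstMoment_empirical_sub_le {n : ℕ} (hn : n ≠ 0) :
    ∫⁻ X : Fin n → E d, ENNReal.ofReal ‖firstMoment (empirical X) t x - firstMoment p t x‖
        ∂(Measure.pi fun _ => p) ≤ ENNReal.ofReal √(1 / n * mass p t x) := by
  have h := lintegral_sqrt_sum_sq_integral_empirical_sub_le p hn (ι := Fin d)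
    (f := fun j y => bump (displacement t x y) * displacement t x y j)
    (g := fun y => bump (displacement t x y))
    (fun j => (continuous_bump_displacement t x).mul
      ((EuclideanSpace.proj (𝕜 := ℝ) j).continuous.comp (continuous_displacement_right t x)))
    (c := 1)
    (fun j y => by
      rw [abs_mul, abs_of_pos (bump_pos _)]
      refine le_trans (mul_le_mul_of_nonneg_left ?_ (bump_pos _).le)
        (bump_mul_norm_le (displacement t x y))
      exact PiLp.norm_apply_le (displacement t x y) j)
    (integrable_bump p t x)
    (fun y => by
      rw [sum_sq_bump_mul]
      have h1 := bump_mul_norm_sq_le (displacement t x y)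
      have h0 := bump_pos (displacement t x y)
      nlinarith)
  refine le_trans (lintegral_mono fun X => ENNReal.ofReal_le_ofReal (le_of_eq ?_)) h
  have := isProbabilityMeasure_empirical hn X
  rw [EuclideanSpace.norm_eq]
  simp only [PiLp.sub_apply, firstMoment_apply, Real.norm_eq_abs, sq_abs]

lemma lintegral_norm_secondMoment_empirical_sub_le {n : ℕ} (hn : n ≠ 0) :
    ∫⁻ X : Fin n → E d, ENNReal.ofReal ‖secondMoment (empirical X) t x - secondMoment p t x‖
        ∂(Measure.pi fun _ => p) ≤ ENNReal.ofReal (2 * √(1 / n * mass p t x)) := by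
  have hw : ∀ (y : E d) (j : Fin d), |displacement t x y j| ≤ ‖displacement t x y‖ :=
    fun y j => PiLp.norm_apply_le (displacement t x y) j
  have hcont : ∀ j : Fin d, Continuous fun y => displacement t x y j := fun j =>
    (EuclideanSpace.proj (𝕜 := ℝ) j).continuous.comp (continuous_displacement_right t x)
  have h := lintegral_sqrt_sum_sq_integral_empirical_sub_le p hn (ι := Fin d × Fin d)
    (f := fun q y => bump (displacement t x y) *
      (displacement t x y q.1 * displacement t x y q.2))
    (g := fun y => 2 ^ 2 * bump (displacement t x y))
    (fun q => (continuous_bump_displacement t x).mul ((hcont q.1).mul (hcont q.2)))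
    (c := 1)
    (fun q y => by
      rw [abs_mul, abs_of_pos (bump_pos _), abs_mul]
      refine le_trans (mul_le_mul_of_nonneg_left ?_ (bump_pos _).le)
        (bump_mul_norm_sq_le (displacement t x y))
      rw [sq]
      exact mul_le_mul (hw y q.1) (hw y q.2) (abs_nonneg _) (norm_nonneg _))
    ((integrable_bump p t x).const_mul _)
    (fun y => by
      rw [sum_sq_bump_mul_mul]
      have h1 := bump_mul_norm_pow_four_le (displacement t x y)
      have h0 := bump_pos (displacement t x y)
      nlinarith)
  have e : 1 / n * ∫ y, 2 ^ 2 * bump (displacement t x y) ∂p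
      = 2 ^ 2 * (1 / n * mass p t x) := by
    rw [integral_const_mul, mass]; ring
  rw [e, Real.sqrt_mul (by norm_num), Real.sqrt_sq (by norm_num)] at h
  refine le_trans (lintegral_mono fun X => ENNReal.ofReal_le_ofReal ?_) h
  have := isProbabilityMeasure_empirical hn X
  refine (norm_le_sqrt_sum_sq _).trans (le_of_eq ?_)
  simp only [sub_apply, PiLp.sub_apply, secondMoment_single_apply]

lemma continuous_mass_empirical {n : ℕ} :
    Continuous fun z : (Fin n → E d) × E d => mass (empirical z.1) t z.2 := by
  simp only [mass, integral_empirical, bump, displacement]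
  fun_prop

lemma continuous_firstMoment_empirical {n : ℕ} :
    Continuous fun z : (Fin n → E d) × E d => firstMoment (empirical z.1) t z.2 := by
  simp only [firstMoment, integral_empirical, bump, displacement]
  fun_prop

/-- The constant is `1 + 1 + 2`. Each deviation is of order `√(P/n)` rather than `n^(-1/2)`, so
division by `P` costs only `P^(-1/2)`. -/
lemma lintegral_momentGap_le {n : ℕ} (hn : n ≠ 0) :
    ∫⁻ X : Fin n → E d, ENNReal.ofReal (momentGap p (empirical X) t x)
        ∂(Measure.pi fun _ => p) ≤ ENNReal.ofReal (4 * √(1 / n * mass p t x)) := by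
  have h0 := lintegral_abs_mass_empirical_sub_le p t x hn
  have h1 := lintegral_norm_firstMoment_empirical_sub_le p t x hn
  have h2 := lintegral_norm_secondMoment_empirical_sub_le p t x hn
  have hpair : Continuous fun X : Fin n → E d => (X, x) := by fun_prop
  have m0 : Measurable fun X : Fin n → E d =>
      ENNReal.ofReal |mass (empirical X) t x - mass p t x| :=
    (((continuous_mass_empirical t).comp hpair).sub
      continuous_const).abs.measurable.ennreal_ofReal
  have m1 : Measurable fun X : Fin n → E d =>
      ENNReal.ofReal ‖firstMoment (empirical X) t x - firstMoment p t x‖ :=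
    (((continuous_firstMoment_empirical t).comp hpair).sub
      continuous_const).norm.measurable.ennreal_ofReal
  calc _ = ∫⁻ X : Fin n → E d, (ENNReal.ofReal |mass (empirical X) t x - mass p t x|
          + ENNReal.ofReal ‖firstMoment (empirical X) t x - firstMoment p t x‖
          + ENNReal.ofReal ‖secondMoment (empirical X) t x - secondMoment p t x‖)
          ∂(Measure.pi fun _ => p) := by
        refine lintegral_congr fun X => ?_
        rw [momentGap, ENNReal.ofReal_add (by positivity) (norm_nonneg _),
          ENNReal.ofReal_add (abs_nonneg _) (norm_nonneg _)]
    _ ≤ _ := by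
        -- Additivity of the lower integral needs only the left summand measurable, so the
        -- operator-valued term requires no measurability proof.
        have m01 : Measurable fun X : Fin n → E d =>
            ENNReal.ofReal |mass (empirical X) t x - mass p t x|
              + ENNReal.ofReal ‖firstMoment (empirical X) t x - firstMoment p t x‖ := m0.add m1
        rw [lintegral_add_left m01, lintegral_add_left m0]
        refine (add_le_add (add_le_add h0 h1) h2).trans (le_of_eq ?_)
        rw [← ENNReal.ofReal_add (by positivity) (by positivity),
          ← ENNReal.ofReal_add (by positivity) (by positivity)]
        congr 1
        ring

end Sampling

/-! ### Gaussian integrals, by completing the square. -/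

section GaussianIntegrals

variable {d : ℕ}

lemma lintegral_exp_neg_mul_norm_sq {b : ℝ} (hb : 0 < b) :
    ∫⁻ v : E d, ENNReal.ofReal (Real.exp (-b * ‖v‖ ^ 2))
      = ENNReal.ofReal ((Real.pi / b) ^ ((d : ℝ) / 2)) := by
  have h := GaussianFourier.integral_rexp_neg_mul_sq_norm (V := E d) hb
  have hpos : 0 < (Real.pi / b) ^ ((d : ℝ) / 2) := by positivity
  rw [finrank_euclideanSpace_fin] at h
  have hint : Integrable fun v : E d => Real.exp (-b * ‖v‖ ^ 2) :=
    Integrable.of_integral_ne_zero (by rw [h]; exact hpos.ne')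
  rw [← h, ofReal_integral_eq_lintegral_ofReal hint (.of_forall fun _ => (Real.exp_pos _).le)]

lemma lintegral_exp_neg_mul_norm_sq_add_inner {b : ℝ} (hb : 0 < b) (w : E d) :
    ∫⁻ v : E d, ENNReal.ofReal (Real.exp (-b * ‖v‖ ^ 2 + inner ℝ w v))
      = ENNReal.ofReal ((Real.pi / b) ^ ((d : ℝ) / 2) * Real.exp (‖w‖ ^ 2 / (4 * b))) := by
  have e : ∀ v : E d, ENNReal.ofReal (Real.exp (-b * ‖v‖ ^ 2 + inner ℝ w v))
      = ENNReal.ofReal (Real.exp (-b * ‖v - (2 * b)⁻¹ • w‖ ^ 2))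
        * ENNReal.ofReal (Real.exp (‖w‖ ^ 2 / (4 * b))) := by
    intro v
    rw [← ENNReal.ofReal_mul (Real.exp_pos _).le, ← Real.exp_add, norm_sub_sq_real,
      inner_smul_right, norm_smul, real_inner_comm, mul_pow, norm_inv,
      Real.norm_of_nonneg (by positivity : 0 ≤ 2 * b)]
    congr 2
    field_simp
    ring
  simp only [e]
  rw [lintegral_mul_const _ (by fun_prop),
    lintegral_sub_right_eq_self
      (fun v : E d => ENNReal.ofReal (Real.exp (-b * ‖v‖ ^ 2))) ((2 * b)⁻¹ • w),
    lintegral_exp_neg_mul_norm_sq hb, ← ENNReal.ofReal_mul (by positivity)]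

lemma lintegral_exp_inner_stdGaussian {t : ℝ} (ht : 0 < t) (v : E d) :
    ∫⁻ w, ENNReal.ofReal (Real.exp (inner ℝ v (√t • w))) ∂stdGaussian (E d)
      = ENNReal.ofReal (Real.exp (‖v‖ ^ 2 * (t / 2))) := by
  have h1 : ∫⁻ w, ENNReal.ofReal (Real.exp (inner ℝ v (√t • w))) ∂stdGaussian (E d)
      = ∫⁻ z, ENNReal.ofReal (Real.exp (inner ℝ v z))
        ∂((stdGaussian (E d)).map fun w => √t • w) := by
    rw [lintegral_map (by fun_prop) (by fun_prop)]
  have hk : Measurable fun x : E d => ENNReal.ofReal (gaussianKernel t x) :=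
    (continuous_gaussianKernel t).measurable.ennreal_ofReal
  rw [h1, map_stdGaussian_eq_withDensity ht,
    lintegral_withDensity_eq_lintegral_mul _ hk (by fun_prop)]
  have hb : 0 < 1 / (2 * t) := by positivity
  have e : ∀ z : E d, ENNReal.ofReal (gaussianKernel t z)
        * ENNReal.ofReal (Real.exp (inner ℝ v z))
      = ENNReal.ofReal (1 / (2 * Real.pi * t) ^ ((d : ℝ) / 2)) *
        ENNReal.ofReal (Real.exp (-(1 / (2 * t)) * ‖z‖ ^ 2 + inner ℝ v z)) := by
    intro z
    rw [← ENNReal.ofReal_mul (gaussianKernel_nonneg ht z),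
      ← ENNReal.ofReal_mul (by positivity), gaussianKernel, mul_assoc, ← Real.exp_add]
    congr 4
    ring
  simp only [Pi.mul_apply, e]
  rw [lintegral_const_mul _ (by fun_prop), lintegral_exp_neg_mul_norm_sq_add_inner hb,
    ← ENNReal.ofReal_mul (by positivity)]
  congr 1
  have e2 : Real.pi / (1 / (2 * t)) = 2 * Real.pi * t := by field_simp
  rw [e2, ← mul_assoc, one_div_mul_cancel (by positivity), one_mul]
  congr 1
  field_simp
  ring

end GaussianIntegrals

/-! ### Exponential moments of `p` and of `Z_t`. -/

section Subgaussian

variable {d : ℕ} {p : Measure (E d)} [IsProbabilityMeasure p] {σ t : ℝ}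

lemma IsSubgaussian.lintegral_exp_inner_le (h : IsSubgaussian p σ) (hσ : 0 < σ) (v : E d) :
    ∫⁻ x, ENNReal.ofReal (Real.exp (inner ℝ v x)) ∂p
      ≤ ENNReal.ofReal (2 * Real.exp (‖v‖ ^ 2 * (σ ^ 2 / 4))) := by
  rcases eq_or_ne v 0 with rfl | hv
  · simp
  have hv0 : 0 < ‖v‖ := norm_pos_iff.2 hv
  obtain ⟨hint, hle⟩ := h (‖v‖⁻¹ • v) (by
    rw [norm_smul, norm_inv, norm_norm, inv_mul_cancel₀ hv0.ne'])
  have key : ∀ x : E d, Real.exp (inner ℝ v x) ≤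
      Real.exp ((inner ℝ x (‖v‖⁻¹ • v) / σ) ^ 2) * Real.exp (‖v‖ ^ 2 * (σ ^ 2 / 4)) := by
    intro x
    rw [← Real.exp_add, Real.exp_le_exp, inner_smul_right, real_inner_comm v x]
    set a := inner ℝ v x
    -- AM-GM: `⟨v, x⟩ ≤ (⟨x, v/‖v‖⟩/σ)² + ‖v‖²σ²/4`.
    have e : (‖v‖⁻¹ * a / σ) ^ 2 + ‖v‖ ^ 2 * (σ ^ 2 / 4) - a
        = (‖v‖⁻¹ * a / σ - ‖v‖ * σ / 2) ^ 2 := by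
      field_simp
      ring
    nlinarith [sq_nonneg (‖v‖⁻¹ * a / σ - ‖v‖ * σ / 2)]
  calc _ ≤ ∫⁻ x, ENNReal.ofReal (Real.exp ((inner ℝ x (‖v‖⁻¹ • v) / σ) ^ 2)
          * Real.exp (‖v‖ ^ 2 * (σ ^ 2 / 4))) ∂p :=
        lintegral_mono fun x => ENNReal.ofReal_le_ofReal (key x)
    _ = ENNReal.ofReal (∫ x, Real.exp ((inner ℝ x (‖v‖⁻¹ • v) / σ) ^ 2)
          * Real.exp (‖v‖ ^ 2 * (σ ^ 2 / 4)) ∂p) :=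
        (ofReal_integral_eq_lintegral_ofReal (hint.mul_const _)
          (.of_forall fun _ => by positivity)).symm
    _ ≤ _ := by
        rw [integral_mul_const]
        gcongr

lemma IsSubgaussian.lintegral_exp_inner_diffusedLaw_le (h : IsSubgaussian p σ) (hσ : 0 < σ)
    (ht : 0 < t) (v : E d) :
    ∫⁻ z, ENNReal.ofReal (Real.exp (inner ℝ v z)) ∂diffusedLaw p t
      ≤ ENNReal.ofReal (2 * Real.exp (‖v‖ ^ 2 * ((σ ^ 2 + 2 * t) / 4))) := by
  rw [diffusedLaw, lintegral_map (by fun_prop) (by fun_prop), lintegral_prod _ (by fun_prop)]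
  have e : ∀ y : E d,
      ∫⁻ w, ENNReal.ofReal (Real.exp (inner ℝ v (y + √t • w))) ∂stdGaussian (E d)
        = ENNReal.ofReal (Real.exp (inner ℝ v y))
          * ENNReal.ofReal (Real.exp (‖v‖ ^ 2 * (t / 2))) := by
    intro y
    rw [← lintegral_exp_inner_stdGaussian ht v, ← lintegral_const_mul _ (by fun_prop)]
    refine lintegral_congr fun w => ?_
    rw [inner_add_right, Real.exp_add, ENNReal.ofReal_mul (Real.exp_pos _).le]
  simp only [e]
  rw [lintegral_mul_const _ (by fun_prop)]
  refine (mul_le_mul_left (h.lintegral_exp_inner_le hσ v) _).trans (le_of_eq ?_)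
  rw [← ENNReal.ofReal_mul (by positivity), mul_assoc, ← Real.exp_add]
  congr 3
  ring

/-- Exponential square integrability of the diffused law, by Gaussian linearization. -/
lemma IsSubgaussian.lintegral_exp_norm_sq_diffusedLaw_le (h : IsSubgaussian p σ) (hσ : 0 < σ)
    (ht : 0 < t) :
    ∫⁻ z, ENNReal.ofReal (Real.exp (‖z‖ ^ 2 / (2 * (σ ^ 2 + 2 * t)))) ∂diffusedLaw p t
      ≤ ENNReal.ofReal (2 * 2 ^ ((d : ℝ) / 2)) := by
  set S := σ ^ 2 + 2 * t with hS
  have hS0 : 0 < S := by positivity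
  have hb : 0 < S / 2 := by positivity
  have hb4 : 0 < S / 4 := by positivity
  set c := (Real.pi / (S / 2)) ^ ((d : ℝ) / 2) with hc
  have hc0 : 0 < c := by positivity
  have : IsProbabilityMeasure (diffusedLaw p t) :=
    Measure.isProbabilityMeasure_map (by fun_prop)
  -- The exponential square is a Gaussian average of linear exponentials. The weight `exp(-S‖v‖²/2)`
  -- is twice as strong as the growth `exp(S‖v‖²/4)` of their expectation; comparing the two
  -- Gaussian integrals gives `2^(d/2)`.
  have e : ∀ z : E d, ENNReal.ofReal (Real.exp (‖z‖ ^ 2 / (2 * S)))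
      = ENNReal.ofReal c⁻¹ *
        ∫⁻ v : E d, ENNReal.ofReal (Real.exp (-(S / 2) * ‖v‖ ^ 2 + inner ℝ z v)) := by
    intro z
    rw [lintegral_exp_neg_mul_norm_sq_add_inner hb, ← ENNReal.ofReal_mul (by positivity),
      ← hc, inv_mul_cancel_left₀ hc0.ne']
    congr 3
    ring
  have hmeas : Measurable fun q : E d × E d =>
      ENNReal.ofReal (Real.exp (-(S / 2) * ‖q.2‖ ^ 2 + inner ℝ q.1 q.2)) := by fun_prop
  have inner_le : ∀ v : E d,
      ∫⁻ z, ENNReal.ofReal (Real.exp (-(S / 2) * ‖v‖ ^ 2 + inner ℝ z v)) ∂diffusedLaw p t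
        ≤ ENNReal.ofReal 2 * ENNReal.ofReal (Real.exp (-(S / 4) * ‖v‖ ^ 2)) := by
    intro v
    have e1 : ∀ z : E d, ENNReal.ofReal (Real.exp (-(S / 2) * ‖v‖ ^ 2 + inner ℝ z v))
        = ENNReal.ofReal (Real.exp (-(S / 2) * ‖v‖ ^ 2))
          * ENNReal.ofReal (Real.exp (inner ℝ v z)) := by
      intro z
      rw [← ENNReal.ofReal_mul (Real.exp_pos _).le, ← Real.exp_add, real_inner_comm]
    simp only [e1]
    rw [lintegral_const_mul _ (by fun_prop)]
    refine (mul_le_mul_right (h.lintegral_exp_inner_diffusedLaw_le hσ ht v) _).trans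
      (le_of_eq ?_)
    rw [← ENNReal.ofReal_mul (by positivity), ← ENNReal.ofReal_mul (by positivity),
      mul_left_comm, ← Real.exp_add]
    congr 3
    rw [← hS]
    ring
  simp only [e]
  rw [lintegral_const_mul _ hmeas.lintegral_prod_right', lintegral_lintegral_swap
    hmeas.aemeasurable]
  calc _ ≤ ENNReal.ofReal c⁻¹ * ∫⁻ v : E d,
          ENNReal.ofReal 2 * ENNReal.ofReal (Real.exp (-(S / 4) * ‖v‖ ^ 2)) :=
        mul_le_mul_right (lintegral_mono inner_le) _
    _ = ENNReal.ofReal (c⁻¹ * (2 * (Real.pi / (S / 4)) ^ ((d : ℝ) / 2))) := by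
        rw [lintegral_const_mul _ (by fun_prop), lintegral_exp_neg_mul_norm_sq hb4,
          ← ENNReal.ofReal_mul (by positivity), ← ENNReal.ofReal_mul (by positivity)]
    _ = _ := by
        congr 1
        rw [show Real.pi / (S / 4) = 2 * (Real.pi / (S / 2)) by field_simp; norm_num,
          Real.mul_rpow (by positivity) (by positivity), ← hc]
        field_simp

end Subgaussian

/-- Hölder against the constant 1; used to pass from the moment of order `-3/4` to those of smaller
order. -/
lemma lintegral_rpow_le_rpow_lintegral {Ω : Type*} [MeasurableSpace Ω] (Q : Measure Ω)
    [IsProbabilityMeasure Q] {f : Ω → ENNReal} (hf : AEMeasurable f Q) {θ : ℝ} (h0 : 0 < θ)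
    (h1 : θ ≤ 1) : ∫⁻ ω, f ω ^ θ ∂Q ≤ (∫⁻ ω, f ω ∂Q) ^ θ := by
  rcases h1.eq_or_lt with rfl | h1
  · simp
  have hpq : (1 / θ).HolderConjugate (1 / (1 - θ)) := by
    rw [Real.holderConjugate_iff]
    constructor
    · rw [lt_div_iff₀ h0]; linarith
    · simp
  have h := ENNReal.lintegral_mul_le_Lp_mul_Lq Q hpq (f := fun ω => f ω ^ θ)
    (g := fun _ => 1) (hf.pow_const _) aemeasurable_const
  simpa [← ENNReal.rpow_mul, h0.ne'] using h

/-! ### Negative moments of the mass under the law of `Z_t`. -/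

section InverseMoments

variable {d : ℕ} {p : Measure (E d)} [IsProbabilityMeasure p] {σ t : ℝ}

lemma continuous_mass (μ : Measure (E d)) [IsProbabilityMeasure μ] (t : ℝ) :
    Continuous (mass μ t) :=
  continuous_iff_continuousAt.2 fun x => (hasFDerivAt_mass μ t x).continuousAt

/-- The 12 is `9 * (4/3)`: first `3(r + 2) ≤ 9m` for `r = σ²/t`, and then `2 ≤ (4/3)³` turns
`2^(d/8)` into a `3d/8` power. -/
lemma inverse_moment_const_le (hσ : 0 < σ) (ht : 0 < t) :
    ((1 / (2 * Real.pi * t) ^ ((d : ℝ) / 2))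
        * (Real.pi / (1 / (6 * (σ ^ 2 + 2 * t)))) ^ ((d : ℝ) / 2)) ^ (3 / 4 : ℝ)
      * (2 * 2 ^ ((d : ℝ) / 2)) ^ (1 / 4 : ℝ)
      ≤ 2 * (12 * max 1 (σ ^ 2 / t)) ^ (3 / 4 * (d : ℝ) / 2) := by
  set m := max 1 (σ ^ 2 / t)
  have hm1 : 1 ≤ m := le_max_left _ _
  have hmr : σ ^ 2 / t ≤ m := le_max_right _ _
  have hratio : Real.pi / (1 / (6 * (σ ^ 2 + 2 * t))) / (2 * Real.pi * t)
      = 3 * (σ ^ 2 / t + 2) := by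
    field_simp
    ring
  have h1 : 1 / (2 * Real.pi * t) ^ ((d : ℝ) / 2)
        * (Real.pi / (1 / (6 * (σ ^ 2 + 2 * t)))) ^ ((d : ℝ) / 2)
      = (3 * (σ ^ 2 / t + 2)) ^ ((d : ℝ) / 2) := by
    rw [one_div_mul_eq_div, ← Real.div_rpow (by positivity) (by positivity), hratio]
  have h2 : ((3 * (σ ^ 2 / t + 2)) ^ ((d : ℝ) / 2)) ^ (3 / 4 : ℝ)
      ≤ (9 * m) ^ (3 / 4 * (d : ℝ) / 2) := by
    rw [← Real.rpow_mul (by positivity), show (d : ℝ) / 2 * (3 / 4) = 3 / 4 * (d : ℝ) / 2 by ring]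
    refine Real.rpow_le_rpow (by positivity) (by linarith) (by positivity)
  have h3 : ((2 : ℝ) * 2 ^ ((d : ℝ) / 2)) ^ (1 / 4 : ℝ)
      ≤ 2 * (4 / 3 : ℝ) ^ (3 / 4 * (d : ℝ) / 2) := by
    rw [Real.mul_rpow (by positivity) (by positivity)]
    refine mul_le_mul ?_ ?_ (by positivity) (by positivity)
    · calc (2 : ℝ) ^ (1 / 4 : ℝ) ≤ 2 ^ (1 : ℝ) :=
            Real.rpow_le_rpow_of_exponent_le (by norm_num) (by norm_num)
        _ = 2 := Real.rpow_one 2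
    · calc ((2 : ℝ) ^ ((d : ℝ) / 2)) ^ (1 / 4 : ℝ)
          ≤ (((4 / 3 : ℝ) ^ (3 : ℝ)) ^ ((d : ℝ) / 2)) ^ (1 / 4 : ℝ) := by
            gcongr
            norm_num
        _ = _ := by
            rw [← Real.rpow_mul (by positivity), ← Real.rpow_mul (by positivity)]
            congr 1
            ring
  rw [h1]
  calc _ ≤ (9 * m) ^ (3 / 4 * (d : ℝ) / 2) * (2 * (4 / 3 : ℝ) ^ (3 / 4 * (d : ℝ) / 2)) :=
        mul_le_mul h2 h3 (by positivity) (by positivity)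
    _ = 2 * ((9 * m) ^ (3 / 4 * (d : ℝ) / 2) * (4 / 3 : ℝ) ^ (3 / 4 * (d : ℝ) / 2)) := by ring
    _ = _ := by
        rw [← Real.mul_rpow (by positivity) (by positivity)]
        congr 2
        ring

/-- The factor `P⁻¹` cancels the density of `Z_t` and leaves Lebesgue measure, so a Gaussian weight
is inserted. Hölder with exponents `4/3` and `4` separates an explicit Gaussian integral from the
exponential square moment. -/
lemma IsSubgaussian.lintegral_mass_rpow_neg_three_quarters_le (h : IsSubgaussian p σ)
    (hσ : 0 < σ) (ht : 0 < t) :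
    ∫⁻ z, ENNReal.ofReal (mass p t z ^ (-(3 / 4) : ℝ)) ∂diffusedLaw p t
      ≤ ENNReal.ofReal (2 * (12 * max 1 (σ ^ 2 / t)) ^ (3 / 4 * (d : ℝ) / 2)) := by
  set S := σ ^ 2 + 2 * t with hS
  have hS0 : 0 < S := by positivity
  have hcont := continuous_mass p t
  have hP := mass_pos p t
  have hm : Measurable (mass p t) := hcont.measurable
  set c := 1 / (2 * Real.pi * t) ^ ((d : ℝ) / 2) with hc
  have hc0 : 0 < c := by positivity
  have hpq : (4 / 3 : ℝ).HolderConjugate 4 := by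
    rw [Real.holderConjugate_iff]; norm_num
  have hHolder := ENNReal.lintegral_mul_le_Lp_mul_Lq (diffusedLaw p t) hpq
    (f := fun z => ENNReal.ofReal
      (mass p t z ^ (-(3 / 4) : ℝ) * Real.exp (-(‖z‖ ^ 2 / (8 * S)))))
    (g := fun z => ENNReal.ofReal (Real.exp (‖z‖ ^ 2 / (8 * S))))
    (by fun_prop) (by fun_prop)
  have e1 : ∀ z : E d, ENNReal.ofReal
        (mass p t z ^ (-(3 / 4) : ℝ) * Real.exp (-(‖z‖ ^ 2 / (8 * S))))
        * ENNReal.ofReal (Real.exp (‖z‖ ^ 2 / (8 * S)))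
      = ENNReal.ofReal (mass p t z ^ (-(3 / 4) : ℝ)) := by
    intro z
    have := hP z
    rw [← ENNReal.ofReal_mul (by positivity), mul_assoc, ← Real.exp_add]
    simp
  have e2 : ∀ z : E d, ENNReal.ofReal
        (mass p t z ^ (-(3 / 4) : ℝ) * Real.exp (-(‖z‖ ^ 2 / (8 * S)))) ^ (4 / 3 : ℝ)
      = ENNReal.ofReal ((mass p t z)⁻¹ * Real.exp (-(1 / (6 * S)) * ‖z‖ ^ 2)) := by
    intro z
    have := hP z
    rw [ENNReal.ofReal_rpow_of_nonneg (by positivity) (by norm_num),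
      Real.mul_rpow (by positivity) (by positivity), ← Real.rpow_mul (hP z).le,
      ← Real.exp_mul, ← Real.rpow_neg_one]
    congr 3
    · norm_num
    · field_simp
      ring
  have e3 : ∀ z : E d, ENNReal.ofReal (Real.exp (‖z‖ ^ 2 / (8 * S))) ^ (4 : ℝ)
      = ENNReal.ofReal (Real.exp (‖z‖ ^ 2 / (2 * S))) := by
    intro z
    rw [ENNReal.ofReal_rpow_of_nonneg (by positivity) (by norm_num), ← Real.exp_mul]
    congr 2
    field_simp
    ring
  have e4 : ∫⁻ z, ENNReal.ofReal ((mass p t z)⁻¹ * Real.exp (-(1 / (6 * S)) * ‖z‖ ^ 2))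
        ∂diffusedLaw p t
      = ENNReal.ofReal (c * (Real.pi / (1 / (6 * S))) ^ ((d : ℝ) / 2)) := by
    rw [diffusedLaw_eq_withDensity p ht, diffusedDensity_eq_mass p ht,
      lintegral_withDensity_eq_lintegral_mul _ (by fun_prop) (by fun_prop)]
    have e5 : ∀ z : E d, ENNReal.ofReal (c * mass p t z) *
          ENNReal.ofReal ((mass p t z)⁻¹ * Real.exp (-(1 / (6 * S)) * ‖z‖ ^ 2))
        = ENNReal.ofReal c * ENNReal.ofReal (Real.exp (-(1 / (6 * S)) * ‖z‖ ^ 2)) := by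
      intro z
      have := hP z
      rw [← ENNReal.ofReal_mul (by positivity), ← ENNReal.ofReal_mul hc0.le]
      congr 1
      field_simp
    simp only [Pi.mul_apply, ← hc, e5]
    rw [lintegral_const_mul _ (by fun_prop), lintegral_exp_neg_mul_norm_sq (by positivity),
      ← ENNReal.ofReal_mul hc0.le]
  simp only [Pi.mul_apply, e1, e2, e3] at hHolder
  rw [e4] at hHolder
  refine hHolder.trans ?_
  have h4 := h.lintegral_exp_norm_sq_diffusedLaw_le hσ ht
  rw [← hS] at h4
  refine (mul_le_mul_right (ENNReal.rpow_le_rpow h4 (by norm_num)) _).trans ?_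
  rw [ENNReal.ofReal_rpow_of_nonneg (by positivity) (by norm_num),
    ENNReal.ofReal_rpow_of_nonneg (by positivity) (by norm_num),
    ← ENNReal.ofReal_mul (by positivity)]
  refine ENNReal.ofReal_le_ofReal ?_
  rw [one_div_div]
  exact inverse_moment_const_le hσ ht

/-- Negative moments of the Gaussian average under the diffused law. -/
lemma IsSubgaussian.lintegral_mass_rpow_neg_le (h : IsSubgaussian p σ) (hσ : 0 < σ)
    (ht : 0 < t) {θ : ℝ} (hθ0 : 0 < θ) (hθ : θ ≤ 3 / 4) :
    ∫⁻ z, ENNReal.ofReal (mass p t z ^ (-θ)) ∂diffusedLaw p t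
      ≤ ENNReal.ofReal (2 * (12 * max 1 (σ ^ 2 / t)) ^ (θ * (d : ℝ) / 2)) := by
  have hm : Measurable (mass p t) := (continuous_mass p t).measurable
  have : IsProbabilityMeasure (diffusedLaw p t) :=
    Measure.isProbabilityMeasure_map (by fun_prop)
  have hP := mass_pos p t
  have hm0 : 0 < max 1 (σ ^ 2 / t) := lt_max_of_lt_left one_pos
  have hJ := lintegral_rpow_le_rpow_lintegral (diffusedLaw p t)
    (f := fun z => ENNReal.ofReal (mass p t z ^ (-(3 / 4) : ℝ))) (by fun_prop)
    (θ := 4 * θ / 3) (by positivity) (by linarith)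
  have e : ∀ z, ENNReal.ofReal (mass p t z ^ (-(3 / 4) : ℝ)) ^ (4 * θ / 3)
      = ENNReal.ofReal (mass p t z ^ (-θ)) := by
    intro z
    have := hP z
    rw [ENNReal.ofReal_rpow_of_nonneg (by positivity) (by positivity),
      ← Real.rpow_mul (hP z).le]
    congr 2
    ring
  simp only [e] at hJ
  refine hJ.trans ((ENNReal.rpow_le_rpow
    (h.lintegral_mass_rpow_neg_three_quarters_le hσ ht) (by positivity)).trans ?_)
  rw [ENNReal.ofReal_rpow_of_nonneg (by positivity) (by positivity)]
  refine ENNReal.ofReal_le_ofReal ?_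
  rw [Real.mul_rpow (by positivity) (by positivity), ← Real.rpow_mul (by positivity)]
  refine mul_le_mul ?_ (le_of_eq ?_) (by positivity) (by positivity)
  · calc (2 : ℝ) ^ (4 * θ / 3) ≤ 2 ^ (1 : ℝ) :=
          Real.rpow_le_rpow_of_exponent_le (by norm_num) (by linarith)
      _ = 2 := Real.rpow_one 2
  · congr 1
    ring

end InverseMoments

/-! ### Numerical comparison with the claimed rate. -/

section Rates

/-- The stochastic rate `√(C_d / n) (m log n)^{d/4}` with `m` in place of `max 1 (σ² / t)`. -/
def rate (d n : ℕ) (m : ℝ) : ℝ :=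
  (√n)⁻¹ * (16 / Real.pi * Real.log n * m) ^ ((d : ℝ) / 4)

lemma dimConst_eq (d : ℕ) : dimConst d = (16 / Real.pi) ^ ((d : ℝ) / 2) := by
  have h : (4 / √Real.pi) = (16 / Real.pi) ^ (1 / 2 : ℝ) := by
    rw [← Real.sqrt_eq_rpow, Real.sqrt_div (by norm_num),
      show (16 : ℝ) = 4 ^ 2 by norm_num, Real.sqrt_sq (by norm_num)]
  rw [dimConst, h, ← Real.rpow_natCast, ← Real.rpow_mul (by positivity)]
  congr 1
  ring

lemma max_one_rpow_le {r s : ℝ} (hr : 0 ≤ r) : (max 1 r) ^ s ≤ 1 + r ^ s := by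
  have := Real.rpow_nonneg hr s
  rcases max_cases 1 r with ⟨h, _⟩ | ⟨h, _⟩ <;> rw [h]
  · rw [Real.one_rpow]; linarith
  · linarith

lemma rate_nonneg (d n : ℕ) {m : ℝ} (hm : 0 ≤ m) : 0 ≤ rate d n m := by
  have := Real.log_natCast_nonneg n
  unfold rate
  positivity

/-- Rewrites the powers of `σ` and `t` through `r = σ²/t`; the only loss is `max(1, r)^s ≤ 1 + r^s`.
-/
lemma div_mul_rate_le (d : ℕ) {n : ℕ} (hn : 2 ≤ n) {σ t : ℝ} (hσ : 0 < σ) (ht : 0 < t) :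
    1 / t * (Real.log n * rate d n (max 1 (σ ^ 2 / t))
        + (Real.log n * rate d n (max 1 (σ ^ 2 / t))) ^ 2)
      ≤ √(dimConst d / n) * (1 / t + σ ^ ((d : ℝ) / 2) / t ^ ((d : ℝ) / 4 + 1))
          * Real.log n ^ ((d : ℝ) / 4 + 1)
        + dimConst d / n * (1 / t + σ ^ d / t ^ ((d : ℝ) / 2 + 1))
          * Real.log n ^ ((d : ℝ) / 2 + 2) := by
  have hL : 0 < Real.log n := by linarith [half_lt_log hn]
  have hn0 : (0 : ℝ) < n := by positivity
  set L := Real.log n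
  set r := σ ^ 2 / t with hr
  have hr0 : 0 < r := by positivity
  have hm0 : 0 < max 1 r := lt_max_of_lt_left one_pos
  have hκ : 0 < 16 / Real.pi := by positivity
  have e1 : σ ^ ((d : ℝ) / 2) / t ^ ((d : ℝ) / 4 + 1) = 1 / t * r ^ ((d : ℝ) / 4) := by
    rw [hr, Real.div_rpow (by positivity) ht.le, ← Real.rpow_natCast, ← Real.rpow_mul hσ.le,
      Real.rpow_add ht, Real.rpow_one]
    have : ((2 : ℕ) : ℝ) * ((d : ℝ) / 4) = (d : ℝ) / 2 := by push_cast; ring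
    rw [this]
    field_simp
  have e2 : σ ^ d / t ^ ((d : ℝ) / 2 + 1) = 1 / t * r ^ ((d : ℝ) / 2) := by
    rw [hr, Real.div_rpow (by positivity) ht.le, ← Real.rpow_natCast, ← Real.rpow_natCast,
      ← Real.rpow_mul hσ.le, Real.rpow_add ht, Real.rpow_one]
    have : ((2 : ℕ) : ℝ) * ((d : ℝ) / 2) = d := by push_cast; ring
    rw [this]
    field_simp
  have e3 : √(dimConst d / n) = (√n)⁻¹ * (16 / Real.pi) ^ ((d : ℝ) / 4) := by
    rw [dimConst_eq, Real.sqrt_div (by positivity), Real.sqrt_eq_rpow ((16 / Real.pi) ^ _),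
      ← Real.rpow_mul hκ.le, div_eq_inv_mul]
    congr 2
    ring
  have e4 : rate d n (max 1 r)
      = (√n)⁻¹ * (16 / Real.pi) ^ ((d : ℝ) / 4) * L ^ ((d : ℝ) / 4)
        * (max 1 r) ^ ((d : ℝ) / 4) := by
    rw [rate, Real.mul_rpow (by positivity) (by positivity),
      Real.mul_rpow (by positivity) (by positivity)]
    ring
  have sq4 : ∀ a : ℝ, 0 < a → (a ^ ((d : ℝ) / 4)) ^ 2 = a ^ ((d : ℝ) / 2) := by
    intro a ha
    rw [← Real.rpow_natCast, ← Real.rpow_mul ha.le]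
    congr 1
    push_cast
    ring
  have e5 : rate d n (max 1 r) ^ 2
      = dimConst d / n * L ^ ((d : ℝ) / 2) * (max 1 r) ^ ((d : ℝ) / 2) := by
    rw [e4, mul_pow, mul_pow, mul_pow, sq4 _ hκ, sq4 _ hL, sq4 _ hm0, inv_pow,
      Real.sq_sqrt hn0.le, dimConst_eq]
    ring
  have e6 : L ^ ((d : ℝ) / 4 + 1) = L ^ ((d : ℝ) / 4) * L := by
    rw [Real.rpow_add hL, Real.rpow_one]
  have e7 : L ^ ((d : ℝ) / 2 + 2) = L ^ ((d : ℝ) / 2) * L ^ 2 := by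
    rw [Real.rpow_add hL]; norm_cast
  have hd : 0 ≤ dimConst d := by rw [dimConst_eq]; positivity
  rw [e1, e2, e3, e6, e7, mul_pow, e5, e4]
  have h1 := max_one_rpow_le (s := (d : ℝ) / 4) hr0.le
  have h2 := max_one_rpow_le (s := (d : ℝ) / 2) hr0.le
  calc _ = 1 / t * (√n)⁻¹ * (16 / Real.pi) ^ ((d : ℝ) / 4) * L ^ ((d : ℝ) / 4) * L
          * (max 1 r) ^ ((d : ℝ) / 4)
        + 1 / t * (dimConst d / n) * L ^ ((d : ℝ) / 2) * L ^ 2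
          * (max 1 r) ^ ((d : ℝ) / 2) := by ring
    _ ≤ 1 / t * (√n)⁻¹ * (16 / Real.pi) ^ ((d : ℝ) / 4) * L ^ ((d : ℝ) / 4) * L
          * (1 + r ^ ((d : ℝ) / 4))
        + 1 / t * (dimConst d / n) * L ^ ((d : ℝ) / 2) * L ^ 2
          * (1 + r ^ ((d : ℝ) / 2)) := by gcongr
    _ = _ := by ring

lemma le_sixteen_div_pi : 5.09 ≤ 16 / Real.pi := by
  rw [le_div_iff₀ Real.pi_pos]
  linarith [Real.pi_lt_d4]

/-- For large samples the two error terms are controlled by the rate. -/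
lemma error_terms_le_rate {d n : ℕ} (hd : 1 ≤ d) (hL : 3 ≤ Real.log n) {m : ℝ} (hm : 1 ≤ m) :
    Real.log n * (4 * (√n)⁻¹ * (2 * (12 * m) ^ (1 / 2 * (d : ℝ) / 2))
        + (Real.log n / n) ^ (3 / 4 : ℝ) * (2 * (12 * m) ^ (3 / 4 * (d : ℝ) / 2)))
      ≤ 10 * (Real.log n * rate d n m + (Real.log n * rate d n m) ^ 2) := by
  have hd' : (1 : ℝ) ≤ d := by exact_mod_cast hd
  have hn0 : (0 : ℝ) ≤ n := by positivity
  have hκ := le_sixteen_div_pi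
  set L := Real.log n
  set κ := 16 / Real.pi
  have hD0 : 0 ≤ rate d n m := rate_nonneg d n (by linarith)
  have h1 : (√n)⁻¹ * (12 * m) ^ (1 / 2 * (d : ℝ) / 2) ≤ rate d n m := by
    unfold rate
    refine mul_le_mul_of_nonneg_left ?_ (by positivity)
    rw [show 1 / 2 * (d : ℝ) / 2 = (d : ℝ) / 4 by ring]
    refine Real.rpow_le_rpow (by positivity) ?_ (by positivity)
    refine mul_le_mul_of_nonneg_right ?_ (by positivity)
    nlinarith
  -- The spare `L^(1/4)` fits because `d ≥ 1` gives exponent at least `3/8`, and `3κ ≥ 12` leaves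
  -- `L/3 ≥ 1` for it.
  have h2 : L ^ (1 / 4 : ℝ) * (12 * m) ^ (3 / 4 * (d : ℝ) / 2)
      ≤ 2 * (κ * L * m) ^ (3 / 4 * (d : ℝ) / 2) := by
    have hL3 : 1 ≤ L / 3 := by linarith
    have e : κ * L * m = κ * 3 / 12 * (L / 3) * (12 * m) := by ring
    have a1 : (L / 3) ^ (1 / 4 : ℝ) * (12 * m) ^ (3 / 4 * (d : ℝ) / 2)
        ≤ (κ * L * m) ^ (3 / 4 * (d : ℝ) / 2) := by
      calc _ ≤ (L / 3) ^ (3 / 4 * (d : ℝ) / 2) * (12 * m) ^ (3 / 4 * (d : ℝ) / 2) := by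
            refine mul_le_mul_of_nonneg_right ?_ (by positivity)
            exact Real.rpow_le_rpow_of_exponent_le hL3 (by linarith)
        _ = (L / 3 * (12 * m)) ^ (3 / 4 * (d : ℝ) / 2) :=
            (Real.mul_rpow (by positivity) (by positivity)).symm
        _ ≤ _ := by
            rw [e]
            refine Real.rpow_le_rpow (by positivity) ?_ (by positivity)
            refine mul_le_mul_of_nonneg_right ?_ (by positivity)
            refine le_mul_of_one_le_left (by positivity) ?_
            linarith
    have a2 : L ^ (1 / 4 : ℝ) ≤ 2 * (L / 3) ^ (1 / 4 : ℝ) := by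
      have : (2 : ℝ) = 16 ^ (1 / 4 : ℝ) := by
        rw [show (16 : ℝ) = 2 ^ (4 : ℝ) by norm_num, ← Real.rpow_mul (by norm_num)]
        norm_num
      rw [this, ← Real.mul_rpow (by norm_num) (by positivity)]
      exact Real.rpow_le_rpow (by positivity) (by linarith) (by norm_num)
    calc _ ≤ 2 * (L / 3) ^ (1 / 4 : ℝ) * (12 * m) ^ (3 / 4 * (d : ℝ) / 2) := by gcongr
      _ = 2 * ((L / 3) ^ (1 / 4 : ℝ) * (12 * m) ^ (3 / 4 * (d : ℝ) / 2)) := by ring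
      _ ≤ _ := by gcongr
  have hL0 : 0 < L := by linarith
  have hn1 : (0 : ℝ) < n := by
    rcases hn0.eq_or_lt with h | h
    · exfalso
      have : L = 0 := by simp [L, ← h]
      linarith
    · exact h
  set y := L * rate d n m with hy
  have hy0 : 0 ≤ y := by positivity
  have hy32 : y ^ (3 / 2 : ℝ)
      = L ^ (3 / 2 : ℝ) * ((n : ℝ) ^ (-(3 / 4) : ℝ) * (κ * L * m) ^ (3 / 4 * (d : ℝ) / 2)) := by
    have hs : (√n)⁻¹ = (n : ℝ) ^ (-(1 / 2) : ℝ) := by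
      rw [Real.sqrt_eq_rpow, Real.rpow_neg hn0]
    rw [hy, rate, hs, Real.mul_rpow (by positivity) (by positivity),
      Real.mul_rpow (by positivity) (by positivity), ← Real.rpow_mul hn0,
      ← Real.rpow_mul (by positivity)]
    congr 3 <;> ring
  have h3 : L * ((L / n) ^ (3 / 4 : ℝ) * (12 * m) ^ (3 / 4 * (d : ℝ) / 2))
      ≤ 2 * y ^ (3 / 2 : ℝ) := by
    have eL : L * L ^ (3 / 4 : ℝ) = L ^ (3 / 2 : ℝ) * L ^ (1 / 4 : ℝ) := by
      rw [← Real.rpow_add hL0]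
      nth_rewrite 1 [← Real.rpow_one L]
      rw [← Real.rpow_add hL0]
      norm_num
    have en : (L / n) ^ (3 / 4 : ℝ) = L ^ (3 / 4 : ℝ) * (n : ℝ) ^ (-(3 / 4) : ℝ) := by
      rw [Real.div_rpow hL0.le hn0, Real.rpow_neg hn0, div_eq_mul_inv]
    rw [hy32, en]
    calc _ = L * L ^ (3 / 4 : ℝ) * (n : ℝ) ^ (-(3 / 4) : ℝ)
            * (12 * m) ^ (3 / 4 * (d : ℝ) / 2) := by ring
      _ = L ^ (3 / 2 : ℝ) * (n : ℝ) ^ (-(3 / 4) : ℝ)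
            * (L ^ (1 / 4 : ℝ) * (12 * m) ^ (3 / 4 * (d : ℝ) / 2)) := by rw [eL]; ring
      _ ≤ L ^ (3 / 2 : ℝ) * (n : ℝ) ^ (-(3 / 4) : ℝ)
            * (2 * (κ * L * m) ^ (3 / 4 * (d : ℝ) / 2)) := by gcongr
      _ = _ := by ring
  -- AM-GM: `y^(3/2)` is the geometric mean of `y` and `y²`.
  have h4 : y ^ (3 / 2 : ℝ) ≤ (y + y ^ 2) / 2 := by
    have e : y ^ (3 / 2 : ℝ) = y * √y := by
      rcases hy0.eq_or_lt with h | h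
      · rw [← h]; norm_num
      · rw [Real.sqrt_eq_rpow]
        nth_rewrite 2 [← Real.rpow_one y]
        rw [← Real.rpow_add h]
        norm_num
    have hs := Real.sq_sqrt hy0
    rw [e]
    nlinarith [sq_nonneg (√y - 1), Real.sqrt_nonneg y]
  have h5 : L * ((√n)⁻¹ * (12 * m) ^ (1 / 2 * (d : ℝ) / 2)) ≤ y := by
    rw [hy]; gcongr
  nlinarith [sq_nonneg y]

/-- For small samples a dimension-free multiple of the rate is large. -/
lemma rpow_le_rate {d n : ℕ} (hn : 2 ≤ n) (hL : Real.log n < 3) {m : ℝ} (hm : 1 ≤ m) :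
    (12 * m) ^ (1 / 4 * (d : ℝ) / 2) ≤ 10 * (Real.log n * rate d n m) := by
  have hn0 : (0 : ℝ) < n := by positivity
  have hκ := le_sixteen_div_pi
  have hL1 := half_lt_log hn
  have hL2 : 0.693 ≤ Real.log n := by
    have h : Real.log 2 ≤ Real.log n := Real.log_le_log two_pos (by exact_mod_cast hn)
    linarith [Real.log_two_gt_d9]
  -- Here `n < e³ < 25`.
  have hs : √n ≤ 5 := by
    rw [Real.sqrt_le_left (by norm_num)]
    have h1 : (n : ℝ) < Real.exp 3 := (Real.log_lt_iff_lt_exp hn0).1 hL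
    have h2 : Real.exp 3 = Real.exp 1 ^ 3 := by rw [← Real.exp_nat_mul]; norm_num
    have h3 : Real.exp 1 ^ 3 ≤ 2.72 ^ 3 :=
      pow_le_pow_left₀ (Real.exp_pos _).le (by linarith [Real.exp_one_lt_d9]) 3
    rw [h2] at h1
    have h4 : (2.72 : ℝ) ^ 3 ≤ 5 ^ 2 := by norm_num
    linarith
  have hsi : 1 / 5 ≤ (√n)⁻¹ := by
    rw [one_div]
    exact inv_anti₀ (by positivity) hs
  set L := Real.log n
  set κ := 16 / Real.pi
  -- For small `n`, `κL` may be below 12, but `(κL)² ≥ 12` always. Hence the moment of order `-1/4`,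
  -- whose exponent `d/8` is half of `d/4`.
  have hkey : (12 * m) ^ (1 / 4 * (d : ℝ) / 2) ≤ (κ * L * m) ^ ((d : ℝ) / 4) := by
    have hκL : 3.5 ≤ κ * L := by nlinarith
    have h12 : 12 * m ≤ (κ * L * m) ^ (2 : ℝ) := by
      rw [Real.rpow_two, mul_pow]
      have : 12 ≤ (κ * L) ^ 2 := by nlinarith
      have hm2 : m ≤ m ^ 2 := by nlinarith
      calc 12 * m ≤ (κ * L) ^ 2 * m := by gcongr
        _ ≤ _ := by gcongr
    calc _ ≤ ((κ * L * m) ^ (2 : ℝ)) ^ (1 / 4 * (d : ℝ) / 2) :=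
          Real.rpow_le_rpow (by positivity) h12 (by positivity)
      _ = _ := by
          rw [← Real.rpow_mul (by positivity)]
          congr 1
          ring
  have hpos : 0 ≤ (κ * L * m) ^ ((d : ℝ) / 4) := by positivity
  have hc : 1 ≤ 10 * (L * (√n)⁻¹) := by nlinarith
  rw [rate]
  calc _ ≤ (κ * L * m) ^ ((d : ℝ) / 4) := hkey
    _ ≤ 10 * (L * (√n)⁻¹) * (κ * L * m) ^ ((d : ℝ) / 4) := le_mul_of_one_le_left hpos hc
    _ = _ := by ring

end Rates

/-! ### Assembly: integrating the error over the data and over `Z_t`. -/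

section MainBound

/-- The Jacobian error, in units of `1 / t`. -/
def jacobianError {d n : ℕ} (p : Measure (E d)) (t : ℝ) (X : Fin n → E d) (x : E d) : ℝ :=
  ‖thresholdedJacobian (empirical X) t (Real.log n / n) x - scaledJacobian p t x‖

lemma norm_jacobian_sub_eq {d n : ℕ} (hn : 2 ≤ n) (p : Measure (E d)) [IsProbabilityMeasure p]
    {t : ℝ} (ht : 0 < t) (X : Fin n → E d) (x : E d) :
    ‖jacobian (scoreEstimator X t) x - jacobian (score p t) x‖
      = 1 / t * jacobianError p t X x := by
  rw [jacobian, jacobian, (hasFDerivAt_scoreEstimator hn X ht x).fderiv,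
    (hasFDerivAt_score p ht x).fderiv,
    ← smul_sub (1 / t) (thresholdedJacobian (empirical X) t (Real.log n / n) x), norm_smul,
    Real.norm_of_nonneg (by positivity), jacobianError]

lemma continuous_scoreEstimator {d n : ℕ} (hn : 2 ≤ n) {t : ℝ} (ht : 0 < t) :
    Continuous fun z : (Fin n → E d) × E d => scoreEstimator z.1 t z.2 := by
  have hm := continuous_mass_empirical (d := d) (n := n) t
  have hf := continuous_firstMoment_empirical (d := d) (n := n) t
  simp only [scoreEstimator_eq hn _ ht]
  refine Continuous.smul (Continuous.div ?_ hm fun z => ?_) (hf.const_smul (√t)⁻¹)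
  · exact Real.smoothTransition.continuous.comp
      (((hm.const_mul 2).div_const _).sub continuous_const)
  · have := isProbabilityMeasure_empirical (by omega) z.1
    exact (mass_pos (empirical z.1) t z.2).ne'

lemma measurable_norm_jacobian_sub {d n : ℕ} (hn : 2 ≤ n) (p : Measure (E d)) {t : ℝ}
    (ht : 0 < t) :
    Measurable fun z : (Fin n → E d) × E d =>
      ‖jacobian (scoreEstimator z.1 t) z.2 - jacobian (score p t) z.2‖ := by
  have h1 : Measurable fun z : (Fin n → E d) × E d => fderiv ℝ (scoreEstimator z.1 t) z.2 :=
    measurable_fderiv_with_param ℝ (f := fun X : Fin n → E d => scoreEstimator X t)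
      (continuous_scoreEstimator hn ht)
  have h2 : Measurable fun z : (Fin n → E d) × E d => fderiv ℝ (score p t) z.2 :=
    (measurable_fderiv ℝ (score p t)).comp measurable_snd
  exact (h1.sub h2).norm

lemma sqrt_div_self_eq {a b : ℝ} (hb : 0 < b) :
    √(1 / a * b) / b = (√a)⁻¹ * b ^ (-(1 / 2) : ℝ) := by
  rw [mul_comm, Real.sqrt_mul hb.le, one_div, Real.sqrt_inv, Real.rpow_neg hb.le,
    ← Real.sqrt_eq_rpow]
  have := Real.mul_self_sqrt hb.le
  have hs : 0 < √b := Real.sqrt_pos.2 hb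
  nth_rewrite 2 [← this]
  field_simp

/-- The integrated Jacobian error. -/
lemma exists_lintegral_jacobianError_le :
    ∃ C : ℝ, 0 < C ∧ ∀ {d n : ℕ} (_ : 2 ≤ n) (p : Measure (E d)) [IsProbabilityMeasure p]
      {σ t : ℝ} (_ : 0 < σ) (_ : 0 < t) (_ : IsSubgaussian p σ),
      ∫⁻ x, ∫⁻ X : Fin n → E d, ENNReal.ofReal (jacobianError p t X x)
          ∂(Measure.pi fun _ => p) ∂diffusedLaw p t
        ≤ ENNReal.ofReal (C * (Real.log n * rate d n (max 1 (σ ^ 2 / t))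
            + (Real.log n * rate d n (max 1 (σ ^ 2 / t))) ^ 2)) := by
  obtain ⟨C, hC, hbound⟩ := exists_norm_thresholdedJacobian_sub_le
  refine ⟨160 * C, by positivity, ?_⟩
  intro d n hn p _ σ t hσ ht hp
  have hn' : n ≠ 0 := by omega
  have hn0 : (0 : ℝ) < n := by positivity
  have hL1 := half_lt_log hn
  have hη := log_div_self_pos hn
  have hm1 : 1 ≤ max 1 (σ ^ 2 / t) := le_max_left _ _
  have hmeas : Measurable (mass p t) := (continuous_mass p t).measurable
  have hR : 0 ≤ Real.log n * rate d n (max 1 (σ ^ 2 / t)) :=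
    mul_nonneg (by linarith) (rate_nonneg d n (by linarith))
  set m := max 1 (σ ^ 2 / t)
  set L := Real.log n
  rcases lt_or_ge L 3 with hL | hL
  -- With boundedly many samples averaging is not exploited: the crude bound holds for every data
  -- set, and `8 = 3 + 1 + 4` collects `L`, the constant in `logMass` and the logarithm.
  · have hpt : ∀ (x : E d) (X : Fin n → E d),
        jacobianError p t X x ≤ 8 * C * mass p t x ^ (-(1 / 4) : ℝ) := by
      intro x X
      have := isProbabilityMeasure_empirical hn' X
      have hP := mass_pos p t x
      have h1 := (hbound hn p (empirical X) t x).2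
      have h2 : 1 ≤ mass p t x ^ (-(1 / 4) : ℝ) :=
        Real.one_le_rpow_of_pos_of_le_one_of_nonpos hP (mass_le_one p t x) (by norm_num)
      have h3 : Real.log (1 / mass p t x) ≤ 4 * mass p t x ^ (-(1 / 4) : ℝ) := by
        have := Real.log_le_rpow_div (x := 1 / mass p t x) (ε := 1 / 4) (by positivity)
          (by norm_num)
        rw [one_div, Real.inv_rpow hP.le, ← Real.rpow_neg hP.le] at this
        rw [one_div]
        linarith
      refine h1.trans ?_
      have h4 : L + logMass p t x ≤ 8 * mass p t x ^ (-(1 / 4) : ℝ) := by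
        unfold logMass
        linarith
      calc _ ≤ C * (8 * mass p t x ^ (-(1 / 4) : ℝ)) := by gcongr
        _ = _ := by ring
    calc _ ≤ ∫⁻ x, ENNReal.ofReal (8 * C) * ENNReal.ofReal (mass p t x ^ (-(1 / 4) : ℝ))
            ∂diffusedLaw p t := by
          refine lintegral_mono fun x => ?_
          refine (lintegral_mono fun X => ENNReal.ofReal_le_ofReal (hpt x X)).trans ?_
          rw [lintegral_const, measure_univ, mul_one, ENNReal.ofReal_mul (by positivity)]
      _ ≤ ENNReal.ofReal (8 * C) *
            ENNReal.ofReal (2 * (12 * m) ^ (1 / 4 * (d : ℝ) / 2)) := by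
          rw [lintegral_const_mul _ (by fun_prop)]
          exact mul_le_mul_right
            (hp.lintegral_mass_rpow_neg_le hσ ht (by norm_num) (by norm_num)) _
      _ ≤ _ := by
          rw [← ENNReal.ofReal_mul (by positivity)]
          refine ENNReal.ofReal_le_ofReal ?_
          have := rpow_le_rate (d := d) hn hL hm1
          calc _ = 16 * C * (12 * m) ^ (1 / 4 * (d : ℝ) / 2) := by ring
            _ ≤ 16 * C * (10 * (L * rate d n m)) := by gcongr
            _ ≤ _ := by nlinarith [sq_nonneg (L * rate d n m)]
  -- `error_terms_le_rate` needs `d ≥ 1`; in dimension 0 all operators coincide.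
  · rcases Nat.eq_zero_or_pos d with rfl | hd
    · have hz : ∀ (x : E 0) (X : Fin n → E 0), jacobianError p t X x = 0 := fun x X =>
        norm_eq_zero.2 (Subsingleton.elim _ _)
      simp [hz]
    have hx : ∀ x : E d, ∫⁻ X : Fin n → E d, ENNReal.ofReal (jacobianError p t X x)
          ∂(Measure.pi fun _ => p)
        ≤ ENNReal.ofReal (C * L * (4 * (√n)⁻¹)) * ENNReal.ofReal (mass p t x ^ (-(1 / 2) : ℝ))
          + ENNReal.ofReal (C * L * (L / n) ^ (3 / 4 : ℝ))
            * ENNReal.ofReal (mass p t x ^ (-(3 / 4) : ℝ)) := by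
      intro x
      have hP := mass_pos p t x
      have hgap : ∀ X : Fin n → E d, ENNReal.ofReal (jacobianError p t X x)
          ≤ ENNReal.ofReal (C * L / mass p t x)
              * ENNReal.ofReal (momentGap p (empirical X) t x)
            + ENNReal.ofReal (C * L * (L / n) ^ (3 / 4 : ℝ))
              * ENNReal.ofReal (mass p t x ^ (-(3 / 4) : ℝ)) := by
        intro X
        have := isProbabilityMeasure_empirical hn' X
        have hg : 0 ≤ momentGap p (empirical X) t x := by unfold momentGap; positivity
        rw [← ENNReal.ofReal_mul (by positivity), ← ENNReal.ofReal_mul (by positivity),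
          ← ENNReal.ofReal_add (by positivity) (by positivity)]
        refine ENNReal.ofReal_le_ofReal ((hbound hn p (empirical X) t x).1.trans (le_of_eq ?_))
        rw [Real.div_rpow hη.le hP.le, Real.rpow_neg hP.le]
        ring
      refine (lintegral_mono hgap).trans ?_
      rw [lintegral_add_right _ measurable_const, lintegral_const, measure_univ, mul_one,
        lintegral_const_mul' _ _ ENNReal.ofReal_ne_top]
      refine add_le_add ((mul_le_mul_right (lintegral_momentGap_le p t x hn') _).trans
        (le_of_eq ?_)) le_rfl
      rw [← ENNReal.ofReal_mul (by positivity), ← ENNReal.ofReal_mul (by positivity)]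
      congr 1
      calc _ = C * L * 4 * (√(1 / n * mass p t x) / mass p t x) := by ring
        _ = _ := by rw [sqrt_div_self_eq hP]; ring
    refine (lintegral_mono hx).trans ?_
    rw [lintegral_add_left (by fun_prop), lintegral_const_mul _ (by fun_prop),
      lintegral_const_mul _ (by fun_prop)]
    refine (add_le_add
      (mul_le_mul_right (hp.lintegral_mass_rpow_neg_le hσ ht (by norm_num) (by norm_num)) _)
      (mul_le_mul_right (hp.lintegral_mass_rpow_neg_le hσ ht (by norm_num) le_rfl) _)).trans ?_
    rw [← ENNReal.ofReal_mul (by positivity), ← ENNReal.ofReal_mul (by positivity),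
      ← ENNReal.ofReal_add (by positivity) (by positivity)]
    refine ENNReal.ofReal_le_ofReal ?_
    have h := error_terms_le_rate hd hL hm1
    calc _ = C * (L * (4 * (√n)⁻¹ * (2 * (12 * m) ^ (1 / 2 * (d : ℝ) / 2))
          + (L / n) ^ (3 / 4 : ℝ) * (2 * (12 * m) ^ (3 / 4 * (d : ℝ) / 2)))) := by ring
      _ ≤ C * (10 * (L * rate d n m + (L * rate d n m) ^ 2)) := by gcongr
      _ ≤ _ := by nlinarith [sq_nonneg (L * rate d n m)]

lemma integrable_and_integral_le_of_lintegral_ofReal_le {Ω : Type*} [MeasurableSpace Ω]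
    {P : Measure Ω} {f : Ω → ℝ} (hf : AEStronglyMeasurable f P) (h0 : ∀ ω, 0 ≤ f ω) {b : ℝ}
    (hb : 0 ≤ b) (h : ∫⁻ ω, ENNReal.ofReal (f ω) ∂P ≤ ENNReal.ofReal b) :
    Integrable f P ∧ ∫ ω, f ω ∂P ≤ b := by
  have hint : Integrable f P := by
    refine ⟨hf, ?_⟩
    rw [hasFiniteIntegral_iff_ofReal (.of_forall h0)]
    exact h.trans_lt ENNReal.ofReal_lt_top
  refine ⟨hint, ?_⟩
  rwa [← ofReal_integral_eq_lintegral_ofReal hint (.of_forall h0),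
    ENNReal.ofReal_le_ofReal_iff hb] at h

end MainBound

end ScoreEstimation

end

theorem proposition2 :
    ∃ C : ℝ, 0 < C ∧
      ∀ (d n : ℕ) (_ : 2 ≤ n) (p : Measure (E d)) [IsProbabilityMeasure p]
        (σ : ℝ) (_ : 0 < σ) (_ : IsSubgaussian p σ) (t : ℝ) (_ : 0 < t),
        Differentiable ℝ (score p t) ∧
        (∀ x : Fin n → E d, Differentiable ℝ (scoreEstimator x t)) ∧
        ∀ (Ω : Type*) [MeasurableSpace Ω] (P : Measure Ω) [IsProbabilityMeasure P]
          (X : Fin n → Ω → E d) (Z : Ω → E d)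
          (_ : ∀ i, HasLaw (X i) p P) (_ : iIndepFun X P)
          (_ : HasLaw Z (diffusedLaw p t) P)
          (_ : IndepFun (fun ω i => X i ω) Z P),
          Integrable (fun ω =>
            ‖jacobian (scoreEstimator (fun i => X i ω) t) (Z ω) - jacobian (score p t) (Z ω)‖) P ∧
          ∫ ω, ‖jacobian (scoreEstimator (fun i => X i ω) t) (Z ω)
              - jacobian (score p t) (Z ω)‖ ∂P ≤
            C * (Real.sqrt (dimConst d / n)
                  * (1 / t + σ ^ ((d : ℝ) / 2) / t ^ ((d : ℝ) / 4 + 1))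
                  * Real.log n ^ ((d : ℝ) / 4 + 1)
                + dimConst d / n
                  * (1 / t + σ ^ d / t ^ ((d : ℝ) / 2 + 1))
                  * Real.log n ^ ((d : ℝ) / 2 + 2)) := by
  obtain ⟨C, hC, hmain⟩ := exists_lintegral_jacobianError_le
  refine ⟨C, hC, ?_⟩
  intro d n hn p _ σ hσ hp t ht
  refine ⟨fun x => (hasFDerivAt_score p ht x).differentiableAt,
    fun X x => (hasFDerivAt_scoreEstimator hn X ht x).differentiableAt, ?_⟩
  intro Ω _ P _ X Z hX hXi hZ hXZ
  -- Independence makes the joint law a product, so the data can be integrated out with the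
  -- evaluation point held fixed.
  have hlaw : HasLaw (fun ω => ((fun i => X i ω), Z ω))
      ((Measure.pi fun _ : Fin n => p).prod (diffusedLaw p t)) P :=
    IndepFun.hasLaw_prod (hXi.hasLaw_pi hX) hZ hXZ
  have : IsProbabilityMeasure (diffusedLaw p t) :=
    Measure.isProbabilityMeasure_map (by fun_prop)
  have hmeas := measurable_norm_jacobian_sub hn p ht
  have hrate := div_mul_rate_le d hn hσ ht
  have hR : 0 ≤ Real.log n * rate d n (max 1 (σ ^ 2 / t)) :=
    mul_nonneg (by linarith [half_lt_log hn])
      (rate_nonneg d n (zero_le_one.trans (le_max_left _ _)))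
  set R := Real.log n * rate d n (max 1 (σ ^ 2 / t))
  have hle : ∫⁻ ω, ENNReal.ofReal ‖jacobian (scoreEstimator (fun i => X i ω) t) (Z ω)
        - jacobian (score p t) (Z ω)‖ ∂P ≤ ENNReal.ofReal (C * (1 / t * (R + R ^ 2))) := by
    have hl := hlaw.lintegral_comp (f := fun z : (Fin n → E d) × E d =>
      ENNReal.ofReal ‖jacobian (scoreEstimator z.1 t) z.2 - jacobian (score p t) z.2‖)
      hmeas.ennreal_ofReal.aemeasurable
    rw [hl, lintegral_prod_symm' _ hmeas.ennreal_ofReal]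
    simp only [norm_jacobian_sub_eq hn p ht,
      ENNReal.ofReal_mul (by positivity : 0 ≤ 1 / t)]
    simp only [lintegral_const_mul' _ _ ENNReal.ofReal_ne_top]
    refine (mul_le_mul_right (hmain hn p hσ ht hp) _).trans (le_of_eq ?_)
    rw [← ENNReal.ofReal_mul (by positivity)]
    congr 1
    ring
  obtain ⟨h1, h2⟩ := integrable_and_integral_le_of_lintegral_ofReal_le
    (hmeas.comp_aemeasurable hlaw.aemeasurable).aestronglyMeasurable
    (fun _ => norm_nonneg _) (by positivity) hle
  exact ⟨h1, h2.trans (mul_le_mul_of_nonneg_left hrate hC.le)⟩
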